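/- Let $t\ge 1$ and $d_1,\dots,d_t\ge 1$. For each $s$ let $\mathcal D_s=\{a(y+I): I=j2^k+[0,2^k)^{d_s},\ k\in\mathbb Z,\ j\in\mathbb Z^{d_s}\}$ be a dyadic grid in $\mathbb R^{d_s}$, where $1\le a\le 2$ and $y\in\mathbb R^{d_s}$ may depend on $s$. Put $h^0=-\mathbf 1_{[-1/2,0)}+\mathbf 1_{[0,1/2)}$ and $h^1=\mathbf 1_{(-1/2,1/2)}$; for an interval $I$ with centre $c(I)$ put $h^{\varepsilon}_I(x)=|I|^{-1/2}h^{\varepsilon}((x-c(I))/|I|)$; and for a cube $Q=I_1\times\cdots\times I_d\in\mathcal D_s$ ($d=d_s$) and a signature $\varepsilon\in\mathrm{Sig}_d=\{0,1\}^d\setminus\{(1,\dots,1)\}$ put $h_Q^\varepsilon(x)=\prod_{i=1}^d h_{I_i}^{\varepsilon_i}(x_i)$. Let $\sigma_s:\mathcal D_s\to\mathcal D_s$ satisfy $\sigma_s(Q)\subseteq Q$ and $2^{d_s}|\sigma_s(Q)|=|Q|$ for all $Q\in\mathcal D_s$, and let $\sigma_s:\mathrm{Sig}_{d_s}\to\mathrm{Sig}_{d_s}\cup\{0\}$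 be any map of signatures. The dyadic Haar shift $\operatorname Q_s$ is the linear operator on the linear span $H_s$ of the Haar functions $h_Q^\varepsilon$ ($Q\in\mathcal D_s$, $\varepsilon\in\mathrm{Sig}_{d_s}$) with $\operatorname Q_s h_Q^\varepsilon=h_{\sigma_s(Q)}^{\sigma_s(\varepsilon)}$, where $h_{\sigma_s(Q)}^{\sigma_s(\varepsilon)}:=0$ if $\sigma_s(\varepsilon)=0$. Let $\vec{\operatorname Q}=\operatorname Q_1\otimes\cdots\otimes\operatorname Q_t$ on $H_1\otimes\cdots\otimes H_t$, whose elements are regarded as functions on $\mathbb R^{\vec d}=\mathbb R^{d_1}\times\cdots\times\mathbb R^{d_t}$ through $(f_1\otimes\cdots\otimes f_t)(x)=\prod_s f_s(x_s)$. Functions are real- or complex-valued. Then $\vec{\operatorname Q}$ extends to a bounded linear operator on $L^2(\mathbb R^{\vec d})$, and for every $1<p<\infty$ it extends, uniquely, to a bounded linear operator from $L^p(\mathbb R^{\vec d})$ to itself, which agrees with the operator on $L^2(\mathbb R^{\vec d})$ on the functions in $L^p(\mathbb R^{\vec d})\cap L^2(\mathbb R^{\vec d})$. -/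

import Mathlib

open MeasureTheory
open scoped ENNReal TensorProduct

noncomputable section

namespace DyadicHaar

/-! ### Dyadic grids -/

/-- The data `(a, y)` of the `d`-dimensional dyadic grid
`{ a • (y + I) : I a canonical dyadic cube }`, with `1 ≤ a ≤ 2` and `y ∈ ℝ^d`. -/
structure DyadicGrid (d : ℕ) where
  scale : ℝ
  shift : Fin d → ℝ
  one_le_scale : 1 ≤ scale
  scale_le_two : scale ≤ 2

/-- Labels `(k, j)` of dyadic cubes; `(k, j)` stands for the canonical cube `j 2^k + [0, 2^k)^d`
and, in a grid with data `(a, y)`, for its image `a • (y + (j 2^k + [0, 2^k)^d))`.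
For `d ≥ 1` different labels give different cubes. -/
abbrev CubeIndex (d : ℕ) : Type := ℤ × (Fin d → ℤ)

namespace DyadicGrid

variable {d : ℕ} (G : DyadicGrid d)

/-- The side length of a cube of the grid. -/
def side (Q : CubeIndex d) : ℝ := G.scale * (2 : ℝ) ^ Q.1

/-- The left endpoint of the `i`-th side of a cube of the grid. -/
def left (Q : CubeIndex d) (i : Fin d) : ℝ :=
  G.scale * (G.shift i + (Q.2 i : ℝ) * (2 : ℝ) ^ Q.1)

/-- The cube of the grid with a given label, as a half-open product of intervals. -/
def cube (Q : CubeIndex d) : Set (Fin d → ℝ) :=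
  Set.univ.pi fun i => Set.Ico (G.left Q i) (G.left Q i + G.side Q)

end DyadicGrid

/-! ### Haar functions -/

/-- `h⁰ = -1_{[-1/2,0)} + 1_{[0,1/2)}` and `h¹ = 1_{(-1/2,1/2)}`. -/
def haarMother (e : Fin 2) (x : ℝ) : ℝ :=
  if e = 0 then
    -(Set.Ico (-(1 / 2) : ℝ) 0).indicator 1 x + (Set.Ico (0 : ℝ) (1 / 2)).indicator 1 x
  else (Set.Ioo (-(1 / 2) : ℝ) (1 / 2)).indicator 1 x

/-- The `L²`-normalized function `h^e_I` of the interval `I` with centre `c` and length `ℓ`. -/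
def haarInterval (e : Fin 2) (c ℓ x : ℝ) : ℝ := ℓ ^ (-(1 / 2) : ℝ) * haarMother e ((x - c) / ℓ)

/-- Signatures: `{0,1}^d` without `(1,…,1)`. -/
abbrev Sig (d : ℕ) : Type := {ε : Fin d → Fin 2 // ε ≠ fun _ => 1}

variable {d : ℕ}

/-- The real Haar function `h_Q^ε` of a cube and a signature. -/
def haarReal (G : DyadicGrid d) (q : CubeIndex d × Sig d) (x : Fin d → ℝ) : ℝ :=
  ∏ i, haarInterval (q.2.1 i) (G.left q.1 i + G.side q.1 / 2) (G.side q.1) (x i)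

/-- The Haar function `h_Q^ε` with values in the scalar field. -/
def haar (𝕜 : Type*) [RCLike 𝕜] (G : DyadicGrid d) (q : CubeIndex d × Sig d) :
    (Fin d → ℝ) → 𝕜 := fun x => (haarReal G q x : 𝕜)

/-! ### Helper facts: the Haar functions are orthonormal, hence linearly independent -/

lemma haarMother_measurable (e : Fin 2) : Measurable (haarMother e) := by
  unfold haarMother
  split_ifs
  · exact ((measurable_one.indicator measurableSet_Ico).neg).add
      (measurable_one.indicator measurableSet_Ico)
  · exact measurable_one.indicator measurableSet_Ioo

lemma haarMother_abs_le (e : Fin 2) (x : ℝ) : |haarMother e x| ≤ 1 := by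
  unfold haarMother
  simp only [Set.indicator_apply, Set.mem_Ico, Set.mem_Ioo, Pi.one_apply]
  split_ifs <;> norm_num

lemma haarMother_eq_zero (e : Fin 2) (x : ℝ) (hx : x < -(1 / 2) ∨ 1 / 2 ≤ x) :
    haarMother e x = 0 := by
  unfold haarMother
  simp only [Set.indicator_apply, Set.mem_Ico, Set.mem_Ioo, Pi.one_apply]
  rcases hx with hx | hx <;> split_ifs <;> (first | (norm_num; done) | (exfalso; grind))

lemma haarMother_integrable (e : Fin 2) : Integrable (haarMother e) := by
  unfold haarMother
  have h (a b : ℝ) : Integrable ((Set.Ico a b).indicator (1 : ℝ → ℝ)) :=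
    (integrable_indicator_iff measurableSet_Ico).2 (integrableOn_const (by simp))
  split_ifs
  · exact (h _ _).neg.add (h _ _)
  · exact (integrable_indicator_iff measurableSet_Ioo).2 (integrableOn_const (by simp))

lemma haarMother_integral : ∫ x, haarMother 0 x = 0 := by
  have h (a b : ℝ) : Integrable ((Set.Ico a b).indicator (1 : ℝ → ℝ)) :=
    (integrable_indicator_iff measurableSet_Ico).2 (integrableOn_const (by simp))
  simp only [haarMother, if_true]
  have h2 := integral_add (h (-(1 / 2)) 0).neg (h 0 (1 / 2))
  simp only [Pi.neg_apply] at h2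
  rw [h2, integral_neg, integral_indicator_one measurableSet_Ico,
    integral_indicator_one measurableSet_Ico]
  norm_num

lemma haarMother_sq_integral (e : Fin 2) : ∫ x, haarMother e x * haarMother e x = 1 := by
  have h : (fun x => haarMother e x * haarMother e x) =ᵐ[volume]
      (Set.Ico (-(1 / 2) : ℝ) (1 / 2)).indicator (1 : ℝ → ℝ) := by
    filter_upwards [compl_mem_ae_iff.2 (measure_singleton (μ := volume) (-(1 / 2) : ℝ))] with x hx
    have hx : x ≠ -(1 / 2) := hx
    unfold haarMother
    simp only [Set.indicator_apply, Set.mem_Ico, Set.mem_Ioo, Pi.one_apply]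
    split_ifs <;> (first | (norm_num; done) | (exfalso; grind))
  rw [integral_congr_ae h, integral_indicator_one measurableSet_Ico]
  norm_num

lemma haarInterval_measurable (e : Fin 2) (c ℓ : ℝ) : Measurable (haarInterval e c ℓ) :=
  ((haarMother_measurable e).comp ((measurable_id.sub_const c).div_const ℓ)).const_mul _

lemma integral_affine (f : ℝ → ℝ) (c : ℝ) {ℓ : ℝ} (hℓ : 0 < ℓ) :
    ∫ x, f ((x - c) / ℓ) = ℓ * ∫ x, f x := by
  rw [integral_sub_right_eq_self (fun x => f (x / ℓ)) c, Measure.integral_comp_div, abs_of_pos hℓ,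
    smul_eq_mul]

lemma haarInterval_sq_integral (e : Fin 2) (c : ℝ) {ℓ : ℝ} (hℓ : 0 < ℓ) :
    ∫ x, haarInterval e c ℓ x * haarInterval e c ℓ x = 1 := by
  have h : ∀ x, haarInterval e c ℓ x * haarInterval e c ℓ x =
      ℓ⁻¹ * (haarMother e ((x - c) / ℓ) * haarMother e ((x - c) / ℓ)) := by
    intro x
    have : ℓ ^ (-(1 / 2) : ℝ) * ℓ ^ (-(1 / 2) : ℝ) = ℓ⁻¹ := by
      rw [← Real.rpow_add hℓ, ← Real.rpow_neg_one]; norm_num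
    rw [← this, haarInterval]; ring
  simp_rw [h]
  rw [integral_const_mul, integral_affine (fun x => haarMother e x * haarMother e x) c hℓ,
    haarMother_sq_integral]
  field_simp

lemma haarInterval_eq_zero (e : Fin 2) (l : ℝ) {ℓ x : ℝ} (hℓ : 0 < ℓ)
    (hx : x < l ∨ l + ℓ ≤ x) : haarInterval e (l + ℓ / 2) ℓ x = 0 := by
  rw [haarInterval, haarMother_eq_zero, mul_zero]
  rcases hx with hx | hx
  · left; rw [div_lt_iff₀ hℓ]; linarith
  · right; rw [le_div_iff₀ hℓ]; linarith

/-- A mean-zero Haar function is orthogonal to functions that are constant on its interval. -/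
lemma haarInterval_mul_integral (l : ℝ) {ℓ : ℝ} (hℓ : 0 < ℓ) (g : ℝ → ℝ) (v : ℝ)
    (hg : ∀ x ∈ Set.Ioo l (l + ℓ), g x = v) :
    ∫ x, haarInterval 0 (l + ℓ / 2) ℓ x * g x = 0 := by
  have h : (fun x => haarInterval 0 (l + ℓ / 2) ℓ x * g x) =ᵐ[volume]
      fun x => v * (ℓ ^ (-(1 / 2) : ℝ) * haarMother 0 ((x - (l + ℓ / 2)) / ℓ)) := by
    filter_upwards [compl_mem_ae_iff.2 (measure_singleton (μ := volume) l)] with x hx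
    have hx : x ≠ l := hx
    by_cases hm : x ∈ Set.Ioo l (l + ℓ)
    · rw [hg x hm, haarInterval]; ring
    · have : x < l ∨ l + ℓ ≤ x := by
        by_contra! hc
        exact hm ⟨lt_of_le_of_ne hc.1 (Ne.symm hx), hc.2⟩
      have h0 := haarInterval_eq_zero 0 l hℓ this
      rw [h0]; rw [haarInterval] at h0; rw [h0]; simp
  rw [integral_congr_ae h, integral_const_mul, integral_const_mul,
    integral_affine _ _ hℓ, haarMother_integral]
  simp

lemma haarInterval_one_eq (l : ℝ) {ℓ x : ℝ} (hℓ : 0 < ℓ) (hx : x ∈ Set.Ioo l (l + ℓ)) :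
    haarInterval 1 (l + ℓ / 2) ℓ x = ℓ ^ (-(1 / 2) : ℝ) := by
  have h1 : -(1 / 2) < (x - (l + ℓ / 2)) / ℓ := by rw [lt_div_iff₀ hℓ]; linarith [hx.1]
  have h2 : (x - (l + ℓ / 2)) / ℓ < 1 / 2 := by rw [div_lt_iff₀ hℓ]; linarith [hx.2]
  rw [haarInterval, haarMother, if_neg (by decide), Set.indicator_of_mem (Set.mem_Ioo.2 ⟨h1, h2⟩)]
  simp

/-- A function `haarInterval` is constant on each of the two open halves and outside. -/
lemma haarInterval_const (e : Fin 2) (l : ℝ) {ℓ : ℝ} (hℓ : 0 < ℓ) (u w : ℝ)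
    (h1 : l ≤ u ∨ w ≤ l) (h2 : l + ℓ / 2 ≤ u ∨ w ≤ l + ℓ / 2) (h3 : l + ℓ ≤ u ∨ w ≤ l + ℓ) :
    ∃ v, ∀ x ∈ Set.Ioo u w, haarInterval e (l + ℓ / 2) ℓ x = v := by
  by_cases ha : w ≤ l
  · exact ⟨0, fun x hx => haarInterval_eq_zero e l hℓ (Or.inl (hx.2.trans_le ha))⟩
  by_cases hb : l + ℓ ≤ u
  · exact ⟨0, fun x hx => haarInterval_eq_zero e l hℓ (Or.inr (hb.trans hx.1.le))⟩
  replace h1 := h1.resolve_right ha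
  replace h3 := h3.resolve_left hb
  fin_cases e
  · rcases h2 with h2 | h2
    · refine ⟨ℓ ^ (-(1 / 2) : ℝ) * 1, fun x hx => ?_⟩
      have k1 : 0 ≤ (x - (l + ℓ / 2)) / ℓ := div_nonneg (by linarith [hx.1]) hℓ.le
      have k2 : (x - (l + ℓ / 2)) / ℓ < 1 / 2 := by rw [div_lt_iff₀ hℓ]; linarith [hx.2]
      simp only [haarInterval, haarMother, Set.indicator_apply, Set.mem_Ico, Pi.one_apply]
      grind
    · refine ⟨ℓ ^ (-(1 / 2) : ℝ) * (-1), fun x hx => ?_⟩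
      have k1 : (x - (l + ℓ / 2)) / ℓ < 0 := div_neg_of_neg_of_pos (by linarith [hx.2]) hℓ
      have k2 : -(1 / 2) ≤ (x - (l + ℓ / 2)) / ℓ := by rw [le_div_iff₀ hℓ]; linarith [hx.1]
      simp only [haarInterval, haarMother, Set.indicator_apply, Set.mem_Ico, Pi.one_apply]
      grind
  · exact ⟨_, fun x hx => haarInterval_one_eq l hℓ ⟨h1.trans_lt hx.1, hx.2.trans_le h3⟩⟩

lemma DyadicGrid.side_pos (G : DyadicGrid d) (Q : CubeIndex d) : 0 < G.side Q :=
  mul_pos (by linarith [G.one_le_scale]) (zpow_pos two_pos _)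

/-- Integrals of products of one-dimensional factors of two Haar functions of one grid. -/
lemma haarReal_mul_integral (G : DyadicGrid d) (q r : CubeIndex d × Sig d) :
    ∫ x, haarReal G q x * haarReal G r x =
      ∏ i, ∫ x, haarInterval (q.2.1 i) (G.left q.1 i + G.side q.1 / 2) (G.side q.1) x *
        haarInterval (r.2.1 i) (G.left r.1 i + G.side r.1 / 2) (G.side r.1) x := by
  simp only [haarReal, ← Finset.prod_mul_distrib]
  exact integral_fintype_prod_volume_eq_prod (𝕜 := ℝ) (fun i x =>
    haarInterval (q.2.1 i) (G.left q.1 i + G.side q.1 / 2) (G.side q.1) x *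
        haarInterval (r.2.1 i) (G.left r.1 i + G.side r.1 / 2) (G.side r.1) x)

lemma haarReal_sq_integral (G : DyadicGrid d) (q : CubeIndex d × Sig d) :
    ∫ x, haarReal G q x * haarReal G q x = 1 := by
  rw [haarReal_mul_integral]
  exact Finset.prod_eq_one fun i _ => haarInterval_sq_integral _ _ (G.side_pos _)

lemma int_sep (a s : ℝ) (ha : 0 < a) (K : ℝ) (hK : 0 < K) (j N : ℤ) :
    a * (s + (N : ℝ) * K) ≤ a * (s + (j : ℝ) * K) ∨
      a * (s + (j : ℝ) * K) + a * K ≤ a * (s + (N : ℝ) * K) := by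
  rcases le_or_gt N j with h | h
  · left
    have : (N : ℝ) ≤ j := by exact_mod_cast h
    gcongr
  · right
    have : (j : ℝ) + 1 ≤ N := by exact_mod_cast h
    have h2 : a * (s + ((j : ℝ) + 1) * K) ≤ a * (s + (N : ℝ) * K) := by gcongr
    linarith

lemma haarReal_integral_of_lt (G : DyadicGrid d) (q r : CubeIndex d × Sig d)
    (h : q.1.1 < r.1.1) : ∫ x, haarReal G q x * haarReal G r x = 0 := by
  rw [haarReal_mul_integral]
  obtain ⟨i, hi⟩ : ∃ i, q.2.1 i ≠ 1 := by
    by_contra! hc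
    exact q.2.2 (funext hc)
  have hi0 : q.2.1 i = 0 := by omega
  refine Finset.prod_eq_zero (Finset.mem_univ i) ?_
  rw [hi0]
  have ha : 0 < G.scale := by linarith [G.one_le_scale]
  have hK : (0 : ℝ) < 2 ^ q.1.1 := zpow_pos two_pos _
  obtain ⟨n, hn⟩ : ∃ n : ℕ, r.1.1 = q.1.1 + 1 + n :=
    ⟨(r.1.1 - q.1.1 - 1).toNat, by omega⟩
  have hpow : (2 : ℝ) ^ r.1.1 = 2 ^ q.1.1 * 2 * 2 ^ n := by
    rw [hn, zpow_add₀ two_ne_zero, zpow_add₀ two_ne_zero, zpow_one, zpow_natCast]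
  have sep := int_sep G.scale (G.shift i) ha _ hK (q.1.2 i)
  obtain ⟨v, hv⟩ := haarInterval_const (r.2.1 i) (G.left r.1 i) (G.side_pos r.1)
    (G.left q.1 i) (G.left q.1 i + G.side q.1)
    (by
      have := sep (r.1.2 i * 2 * 2 ^ n)
      simp only [DyadicGrid.left, DyadicGrid.side, hpow]
      push_cast at this
      convert this using 2 <;> ring)
    (by
      have := sep (r.1.2 i * 2 * 2 ^ n + 2 ^ n)
      simp only [DyadicGrid.left, DyadicGrid.side, hpow]
      push_cast at this
      convert this using 2 <;> ring)
    (by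
      have := sep (r.1.2 i * 2 * 2 ^ n + 2 * 2 ^ n)
      simp only [DyadicGrid.left, DyadicGrid.side, hpow]
      push_cast at this
      convert this using 2 <;> ring)
  exact haarInterval_mul_integral _ (G.side_pos _) _ v hv

lemma haarReal_integral_of_ne (G : DyadicGrid d) (q r : CubeIndex d × Sig d) (h : q ≠ r) :
    ∫ x, haarReal G q x * haarReal G r x = 0 := by
  rcases lt_trichotomy q.1.1 r.1.1 with hlt | heq | hgt
  · exact haarReal_integral_of_lt G q r hlt
  · have hside : G.side q.1 = G.side r.1 := by simp only [DyadicGrid.side, heq]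
    rw [haarReal_mul_integral]
    by_cases hj : q.1.2 = r.1.2
    · have hQ : q.1 = r.1 := Prod.ext heq hj
      have hε : q.2.1 ≠ r.2.1 := fun hc => h (Prod.ext hQ (Subtype.ext hc))
      obtain ⟨i, hi⟩ := Function.ne_iff.1 hε
      refine Finset.prod_eq_zero (Finset.mem_univ i) ?_
      rw [hQ]
      have key : ∫ x, haarInterval 0 (G.left r.1 i + G.side r.1 / 2) (G.side r.1) x *
          haarInterval 1 (G.left r.1 i + G.side r.1 / 2) (G.side r.1) x = 0 :=
        haarInterval_mul_integral _ (G.side_pos _) _ _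
          fun x hx => haarInterval_one_eq _ (G.side_pos _) hx
      rcases (by omega : (q.2.1 i = 0 ∧ r.2.1 i = 1) ∨ (q.2.1 i = 1 ∧ r.2.1 i = 0)) with
        ⟨h1, h2⟩ | ⟨h1, h2⟩
      · rw [h1, h2]; exact key
      · rw [h1, h2, ← key]; exact integral_congr_ae (.of_forall fun x => mul_comm _ _)
    · obtain ⟨i, hi⟩ := Function.ne_iff.1 hj
      refine Finset.prod_eq_zero (Finset.mem_univ i) ?_
      have ha : 0 < G.scale := by linarith [G.one_le_scale]
      have hK : (0 : ℝ) < 2 ^ r.1.1 := zpow_pos two_pos _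
      have hsep : G.left q.1 i + G.side q.1 ≤ G.left r.1 i ∨
          G.left r.1 i + G.side r.1 ≤ G.left q.1 i := by
        simp only [DyadicGrid.left, DyadicGrid.side, heq]
        rcases lt_or_gt_of_ne hi with h1 | h1
        · left
          have := (int_sep G.scale (G.shift i) ha _ hK (q.1.2 i) (r.1.2 i)).resolve_left (by
            push Not
            have : (q.1.2 i : ℝ) < r.1.2 i := by exact_mod_cast h1
            gcongr)
          exact this
        · right
          have := (int_sep G.scale (G.shift i) ha _ hK (r.1.2 i) (q.1.2 i)).resolve_left (by
            push Not
            have : (r.1.2 i : ℝ) < q.1.2 i := by exact_mod_cast h1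
            gcongr)
          exact this
      rw [← integral_zero ℝ ℝ]
      refine integral_congr_ae (.of_forall fun x => ?_)
      show _ * _ = (0 : ℝ)
      by_cases hx : x < G.left q.1 i ∨ G.left q.1 i + G.side q.1 ≤ x
      · rw [haarInterval_eq_zero _ _ (G.side_pos _) hx, zero_mul]
      · rw [mul_eq_zero]; right
        refine haarInterval_eq_zero _ _ (G.side_pos _) ?_
        push Not at hx
        rcases hsep with h1 | h1
        · left; linarith
        · right; linarith
  · rw [← haarReal_integral_of_lt G r q hgt]
    exact integral_congr_ae (.of_forall fun x => mul_comm _ _)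

lemma haarReal_measurable (G : DyadicGrid d) (q : CubeIndex d × Sig d) :
    Measurable (haarReal G q) :=
  Finset.measurable_prod _ fun i _ => (haarInterval_measurable _ _ _).comp (measurable_pi_apply i)

lemma haarReal_abs_le (G : DyadicGrid d) (q : CubeIndex d × Sig d) :
    ∃ C, ∀ x, |haarReal G q x| ≤ C := by
  refine ⟨∏ _i : Fin d, |G.side q.1 ^ (-(1 / 2) : ℝ)|, fun x => ?_⟩
  rw [haarReal, Finset.abs_prod]
  refine Finset.prod_le_prod (fun _ _ => abs_nonneg _) fun i _ => ?_
  rw [haarInterval, abs_mul]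
  exact mul_le_of_le_one_right (abs_nonneg _) (haarMother_abs_le _ _)

lemma haarReal_eq_zero (G : DyadicGrid d) (q : CubeIndex d × Sig d) (x : Fin d → ℝ)
    (hx : x ∉ G.cube q.1) : haarReal G q x = 0 := by
  simp only [DyadicGrid.cube, Set.mem_univ_pi, not_forall] at hx
  obtain ⟨i, hi⟩ := hx
  refine Finset.prod_eq_zero (Finset.mem_univ i) (haarInterval_eq_zero _ _ (G.side_pos _) ?_)
  by_contra! hc
  exact hi hc

lemma DyadicGrid.cube_isBounded (G : DyadicGrid d) (Q : CubeIndex d) :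
    Bornology.IsBounded (G.cube Q) :=
  Bornology.IsBounded.pi fun _ => Metric.isBounded_Ico _ _

variable {𝕜 : Type*} [RCLike 𝕜]

/-- Measurable bounded functions that vanish outside a bounded set. -/
def IsBddFun {X : Type*} [MeasurableSpace X] [Bornology X] (f : X → 𝕜) : Prop :=
  Measurable f ∧ (∃ C : ℝ, ∀ x, ‖f x‖ ≤ C) ∧ Bornology.IsBounded (Function.support f)

lemma IsBddFun.zero {X : Type*} [MeasurableSpace X] [Bornology X] :
    IsBddFun (0 : X → 𝕜) :=
  ⟨measurable_zero, ⟨0, by simp⟩, by simp⟩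

lemma IsBddFun.add {X : Type*} [MeasurableSpace X] [Bornology X] {f g : X → 𝕜}
    (hf : IsBddFun f) (hg : IsBddFun g) : IsBddFun (f + g) := by
  obtain ⟨mf, ⟨C, hC⟩, bf⟩ := hf
  obtain ⟨mg, ⟨D, hD⟩, bg⟩ := hg
  exact ⟨mf.add mg, ⟨C + D, fun x => (norm_add_le _ _).trans (add_le_add (hC x) (hD x))⟩,
    (bf.union bg).subset (Function.support_add f g)⟩

lemma IsBddFun.smul {X : Type*} [MeasurableSpace X] [Bornology X] {f : X → 𝕜}
    (c : 𝕜) (hf : IsBddFun f) : IsBddFun (c • f) := by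
  obtain ⟨mf, ⟨C, hC⟩, bf⟩ := hf
  refine ⟨mf.const_smul c, ⟨‖c‖ * C, fun x => ?_⟩, bf.subset (Function.support_const_smul_subset c f)⟩
  rw [Pi.smul_apply, norm_smul]
  exact mul_le_mul_of_nonneg_left (hC x) (norm_nonneg _)

lemma IsBddFun.memLp {ι : Type*} [Fintype ι] {d : ι → ℕ} {f : (∀ i, Fin (d i) → ℝ) → 𝕜}
    (hf : IsBddFun f) (p : ℝ≥0∞) : MemLp f p volume := by
  obtain ⟨mf, ⟨C, hC⟩, bf⟩ := hf
  exact (memLp_top_of_bound mf.aestronglyMeasurable C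
    (.of_forall hC)).mono_exponent_of_measure_support_ne_top
      (s := Function.support f) (fun x hx => by simpa using hx) bf.measure_lt_top.ne le_top

lemma haar_isBddFun (G : DyadicGrid d) (q : CubeIndex d × Sig d) : IsBddFun (haar 𝕜 G q) := by
  refine ⟨RCLike.measurable_ofReal.comp (haarReal_measurable G q), ?_,
    (G.cube_isBounded q.1).subset fun x hx => ?_⟩
  · obtain ⟨C, hC⟩ := haarReal_abs_le G q
    exact ⟨C, fun x => by simpa [haar] using hC x⟩
  · by_contra hc
    exact hx (by simp [haar, haarReal_eq_zero G q x hc])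

lemma haarReal_mul_integrable (G : DyadicGrid d) (q r : CubeIndex d × Sig d) :
    Integrable fun x => haarReal G q x * haarReal G r x := by
  obtain ⟨C, hC⟩ := haarReal_abs_le G q
  obtain ⟨D, hD⟩ := haarReal_abs_le G r
  have h : IntegrableOn (fun x => haarReal G q x * haarReal G r x) (G.cube q.1) := by
    refine Measure.integrableOn_of_bounded (M := C * D) (G.cube_isBounded q.1).measure_lt_top.ne
      ((haarReal_measurable G q).mul (haarReal_measurable G r)).aestronglyMeasurable
      (.of_forall fun x => ?_)
    rw [norm_mul]
    exact mul_le_mul (hC x) (hD x) (norm_nonneg _) ((abs_nonneg _).trans (hC x))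
  exact (integrableOn_iff_integrable_of_support_subset fun x hx => by
    by_contra hc
    exact hx (by simp [haarReal_eq_zero G q x hc])).1 h

lemma haar_linearIndependent (G : DyadicGrid d) : LinearIndependent 𝕜 (haar 𝕜 G) := by
  classical
  rw [linearIndependent_iff']
  intro s c hc r hr
  have h1 : ∫ x, ∑ q ∈ s, c q * ((haarReal G q x * haarReal G r x : ℝ) : 𝕜) = 0 := by
    rw [← integral_zero (Fin d → ℝ) 𝕜]
    refine integral_congr_ae (.of_forall fun x => ?_)
    have hx := congrFun hc x
    simp only [Finset.sum_apply, Pi.smul_apply, smul_eq_mul, haar, Pi.zero_apply] at hx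
    simp only [RCLike.ofReal_mul, ← mul_assoc, ← Finset.sum_mul, hx, zero_mul]
  rw [integral_finsetSum _ fun q _ => ((haarReal_mul_integrable G q r).ofReal.const_mul _)] at h1
  simp only [integral_const_mul, integral_ofReal] at h1
  rw [Finset.sum_eq_single_of_mem r hr fun q _ hq => by
    rw [haarReal_integral_of_ne G q r hq]; simp, haarReal_sq_integral] at h1
  simpa using h1

/-! ### One-parameter dyadic Haar shifts -/

/-- The linear span of the Haar functions of a grid. -/
abbrev haarSpan (𝕜 : Type*) [RCLike 𝕜] (G : DyadicGrid d) : Submodule 𝕜 ((Fin d → ℝ) → 𝕜) :=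
  Submodule.span 𝕜 (Set.range (haar 𝕜 G))

/-- The Haar functions as an algebraic basis of their span. -/
def haarBasis (𝕜 : Type*) [RCLike 𝕜] (G : DyadicGrid d) :
    Module.Basis (CubeIndex d × Sig d) 𝕜 (haarSpan 𝕜 G) :=
  Module.Basis.span (haar_linearIndependent G)

/-- The data of a Haar shift: a map `σ` of the cubes of the grid with `σ(Q) ⊆ Q` and
`2^d |σ(Q)| = |Q|`, and a map `σ : Sig → Sig ∪ {0}` of signatures (`none` stands for `0`). -/
structure ShiftData (G : DyadicGrid d) where
  onCube : CubeIndex d → CubeIndex d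
  onSig : Sig d → Option (Sig d)
  cube_subset : ∀ Q, G.cube (onCube Q) ⊆ G.cube Q
  volume_cube : ∀ Q, 2 ^ d * volume (G.cube (onCube Q)) = volume (G.cube Q)

/-- The Haar shift: the linear map with `h_Q^ε ↦ h_{σ(Q)}^{σ(ε)}`, where `h^0 = 0`. -/
def haarShift (𝕜 : Type*) [RCLike 𝕜] {G : DyadicGrid d} (σ : ShiftData G) :
    haarSpan 𝕜 G →ₗ[𝕜] haarSpan 𝕜 G :=
  (haarBasis 𝕜 G).constr 𝕜 fun q =>
    match σ.onSig q.2 with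
    | none => 0
    | some ε => haarBasis 𝕜 G (σ.onCube q.1, ε)

/-! ### Tensor products -/

/-- The product space `ℝ^{d_1} ⊗ ⋯ ⊗ ℝ^{d_t}`; it carries the product Lebesgue measure. -/
abbrev ProdSpace {t : ℕ} (d : Fin t → ℕ) : Type := ∀ s, Fin (d s) → ℝ

section Tensor

variable {t : ℕ} {d : Fin t → ℕ} (𝕜) (G : ∀ s, DyadicGrid (d s))

/-- The algebraic tensor product of the spans of the one-parameter Haar functions. -/
abbrev HaarTensor : Type _ := ⨂[𝕜] s, haarSpan 𝕜 (G s)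

/-- The function `f_1(x_1) ⋯ f_t(x_t)` of a pure tensor `f_1 ⊗ ⋯ ⊗ f_t`, extended linearly. -/
def tensorFun : HaarTensor 𝕜 G →ₗ[𝕜] (ProdSpace d → 𝕜) :=
  PiTensorProduct.lift
    ((MultilinearMap.mkPiAlgebra 𝕜 (Fin t) (ProdSpace d → 𝕜)).compLinearMap fun s =>
      (LinearMap.funLeft 𝕜 𝕜 fun x : ProdSpace d => x s) ∘ₗ (haarSpan 𝕜 (G s)).subtype)

variable {𝕜 G}

lemma tensorFun_tprod (f : ∀ s, haarSpan 𝕜 (G s)) (x : ProdSpace d) :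
    tensorFun 𝕜 G (PiTensorProduct.tprod 𝕜 f) x = ∏ s, (f s : (Fin (d s) → ℝ) → 𝕜) (x s) := by
  simp [tensorFun, LinearMap.funLeft_apply]

lemma haarSpan_isBddFun {n : ℕ} {H : DyadicGrid n} (f : haarSpan 𝕜 H) :
    IsBddFun (f : (Fin n → ℝ) → 𝕜) := by
  obtain ⟨f, hf⟩ := f
  induction hf using Submodule.span_induction with
  | mem x hx => obtain ⟨q, rfl⟩ := hx; exact haar_isBddFun H q
  | zero => exact IsBddFun.zero
  | add x y _ _ hx hy => exact hx.add hy
  | smul c x _ hx => exact hx.smul c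

lemma tensorFun_isBddFun (u : HaarTensor 𝕜 G) : IsBddFun (tensorFun 𝕜 G u) := by
  induction u using PiTensorProduct.induction_on with
  | smul_tprod r f =>
    rw [map_smul]
    refine IsBddFun.smul r ?_
    have hf := fun s => haarSpan_isBddFun (f s)
    choose C hC using fun s => (hf s).2.1
    have he : tensorFun 𝕜 G (PiTensorProduct.tprod 𝕜 f) =
        fun x => ∏ s, (f s : (Fin (d s) → ℝ) → 𝕜) (x s) := funext (tensorFun_tprod f)
    rw [he]
    refine ⟨Finset.measurable_prod _ fun s _ => (hf s).1.comp (measurable_pi_apply s),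
      ⟨∏ s, C s, fun x => ?_⟩, (Bornology.IsBounded.pi fun s => (hf s).2.2).subset ?_⟩
    · rw [norm_prod]
      exact Finset.prod_le_prod (fun _ _ => norm_nonneg _) fun s _ => hC s _
    · intro x hx s _
      exact Finset.prod_ne_zero_iff.1 hx s (Finset.mem_univ s)
  | add x y hx hy => rw [map_add]; exact hx.add hy

variable (𝕜 G)

/-- An element of the algebraic tensor product as an element of `L^p(ℝ^{d_1} ⊗ ⋯ ⊗ ℝ^{d_t})`. -/
def tensorToLp (p : ℝ≥0∞) :
    HaarTensor 𝕜 G →ₗ[𝕜] Lp 𝕜 p (volume : Measure (ProdSpace d)) where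
  toFun u := ((tensorFun_isBddFun u).memLp p).toLp (tensorFun 𝕜 G u)
  map_add' u v := by
    rw [← MemLp.toLp_add]
    exact MemLp.toLp_congr _ _ (by rw [map_add])
  map_smul' c u := by
    rw [RingHom.id_apply, ← MemLp.toLp_const_smul]
    exact MemLp.toLp_congr _ _ (by rw [map_smul])

variable {G}

/-- The tensor product `Q_1 ⊗ ⋯ ⊗ Q_t` of the one-parameter Haar shifts. -/
def tensorShift (σ : ∀ s, ShiftData (G s)) : HaarTensor 𝕜 G →ₗ[𝕜] HaarTensor 𝕜 G :=
  PiTensorProduct.map fun s => haarShift 𝕜 (σ s)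

variable {𝕜}

/-- The bounded operator `T` on `L^p(ℝ^{d_1} ⊗ ⋯ ⊗ ℝ^{d_t})` extends `Q_1 ⊗ ⋯ ⊗ Q_t`. -/
def ExtendsTensorShift (σ : ∀ s, ShiftData (G s)) (p : ℝ≥0∞) [Fact (1 ≤ p)]
    (T : Lp 𝕜 p (volume : Measure (ProdSpace d)) →L[𝕜]
      Lp 𝕜 p (volume : Measure (ProdSpace d))) : Prop :=
  ∀ u : HaarTensor 𝕜 G, T (tensorToLp 𝕜 G p u) = tensorToLp 𝕜 G p (tensorShift 𝕜 σ u)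

end Tensor

end DyadicHaar

end

/-! The heart is a one-parameter bilinear estimate on a dyadic tree. Pairing the shifted function
with g and expanding in Haar functions multiplies a coefficient of f on a cube Q by a coefficient of
g on σ(Q), and σ(Q) is a child of Q. A Haar function has mean zero and is constant on the children
of its cube, so its coefficient is at most a multiple of the oscillation of the averages over those
children (`norm_integral_haar_mul_le`). It therefore suffices to bound the sum of |Q| osc_f(Q)
osc_g(σ(Q)) by ‖f‖_p^p + ‖g‖_q^q. Absolute values are already inside the sum, which is why the
signature map may be arbitrary.

For p ≤ 2 let m be a running maximum of the averages of |f| down the tree. The weighted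
arithmetic-geometric inequality splits each product into energies osc_f² m^(p-2) and osc_g² m^(2-p).
From a node to a child m grows at most by the number of children, so the weights remain comparable
(`mixed_le`). The potential `bellmanFun` loses on average at least these energies in each generation
(`bellmanFun_step`) and stays nonnegative (`bellmanFun_nonneg`); summation over a finite tree gives
`mixedSum_le_bellmanFun`. For p ≥ 2 the roles of f and g are exchanged, so `mixedSum` is symmetric
from the start. Testing against the dual function of the shifted f converts the bilinear bound into
an L^p bound.

For tensor products, each slice of a tensor in one variable is again a Haar sum. The one-parameter
bound holds on every slice, Tonelli's theorem integrates it, and the constants of the t variables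
multiply.

The extension needs density. Up to a Haar sum, the indicator of a cube equals 2^(-dn) times the
indicator of its n-th ancestor, and this remainder tends to zero in L^p because p > 1. Indicators of
boxes, measurable sets and simple functions follow. Approximation is carried out in L^p and L^r at
once, so that the extensions to the two spaces agree on common functions, by uniqueness of limits in
measure. -/

noncomputable section

namespace DyadicHaar

/-! ### A Bellman function estimate on trees -/

section Tree

variable {T ι : Type*} [Fintype ι]

/-- The average of a function over the children of a node. -/
def childAvg (child : T → ι → T) (h : T → ℝ) (Q : T) : ℝ :=
  (∑ e, h (child Q e)) / Fintype.card ι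

/-- The sum over the first `n` generations below `Q` of the mixed products of `α` and `β`
at a node and its children, normalized by the relative size of the node. -/
def mixedSum (child : T → ι → T) (α β : T → ℝ) : ℕ → T → ℝ
  | 0, _ => 0
  | n + 1, Q => (∑ e, (α Q * β (child Q e) + β Q * α (child Q e))) / Fintype.card ι +
      childAvg child (mixedSum child α β n) Q

/-- The averages `F` of `|f|`, the squared absolute value `U` of the averages of `f`,
and the averages `P` of `|f|^p` along a tree, with `α` a bound for the oscillation of `f`. -/
structure IsAvgSystem (child : T → ι → T) (p : ℝ) (F U P α : T → ℝ) : Prop where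
  F_nonneg : ∀ Q, 0 ≤ F Q
  F_avg : ∀ Q, childAvg child F Q = F Q
  U_nonneg : ∀ Q, 0 ≤ U Q
  U_le : ∀ Q, U Q ≤ F Q ^ 2
  P_avg : ∀ Q, childAvg child P Q = P Q
  F_pow_le : ∀ Q, F Q ^ p ≤ P Q
  α_nonneg : ∀ Q, 0 ≤ α Q
  α_sq_le : ∀ Q, α Q ^ 2 ≤ childAvg child U Q - U Q

lemma childAvg_le_childAvg {child : T → ι → T} {h k : T → ℝ} {Q : T}
    (hk : ∀ e, h (child Q e) ≤ k (child Q e)) : childAvg child h Q ≤ childAvg child k Q := by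
  unfold childAvg
  gcongr with e
  exact hk e

lemma childAvg_add {child : T → ι → T} {h k : T → ℝ} {Q : T} :
    childAvg child (fun R => h R + k R) Q = childAvg child h Q + childAvg child k Q := by
  simp only [childAvg, Finset.sum_add_distrib, add_div]

lemma childAvg_sub {child : T → ι → T} {h k : T → ℝ} {Q : T} :
    childAvg child (fun R => h R - k R) Q = childAvg child h Q - childAvg child k Q := by
  simp only [childAvg, Finset.sum_sub_distrib, sub_div]

lemma childAvg_const_mul {child : T → ι → T} {h : T → ℝ} {Q : T} (c : ℝ) :
    childAvg child (fun R => c * h R) Q = c * childAvg child h Q := by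
  simp only [childAvg, ← Finset.mul_sum, mul_div_assoc]

lemma childAvg_const [Nonempty ι] {child : T → ι → T} {Q : T} (c : ℝ) :
    childAvg child (fun _ => c) Q = c := by
  simp [childAvg]

lemma mixedSum_comm (child : T → ι → T) (α β : T → ℝ) (n : ℕ) (Q : T) :
    mixedSum child α β n Q = mixedSum child β α n Q := by
  induction n generalizing Q with
  | zero => rfl
  | succ n ih =>
    simp only [mixedSum, childAvg, ih]
    congr 2
    exact Finset.sum_congr rfl fun e _ => add_comm _ _

/-- Young's inequality tuned to spend only half of (p - 1) m^p; `bellmanFun_nonneg` lives on the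
other half. The threshold k satisfies p k = (p - 1) / 2, which settles x ≤ k m, while for x > k m
the number m is at most x / k. -/
lemma exists_young_bound {p : ℝ} (hp : 1 < p) : ∃ C : ℝ, 0 ≤ C ∧ ∀ m x : ℝ, 0 < m → 0 ≤ x →
    p * m ^ (p - 1) * x ≤ (p - 1) / 2 * m ^ p + C * x ^ p := by
  set k := (p - 1) / (2 * p) with hk
  have hk0 : 0 < k := by positivity [sub_pos.2 hp]
  refine ⟨p * (k⁻¹) ^ (p - 1), by positivity, fun m x hm hx => ?_⟩
  have e1 : m ^ p = m ^ (p - 1) * m := by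
    rw [← Real.rpow_add_one hm.ne']; congr 1; ring
  rcases le_or_gt x (k * m) with h | h
  · have h0 : 0 ≤ p * k⁻¹ ^ (p - 1) * x ^ p := by positivity
    have : p * m ^ (p - 1) * x ≤ p * m ^ (p - 1) * (k * m) := by gcongr
    have e2 : p * m ^ (p - 1) * (k * m) = (p - 1) / 2 * m ^ p := by
      rw [e1, hk]; field_simp
    linarith
  · have hx0 : 0 < x := (by positivity : 0 < k * m).trans h
    have h1 : m ≤ k⁻¹ * x := by rw [le_inv_mul_iff₀ hk0]; exact h.le
    have h2 : m ^ (p - 1) ≤ (k⁻¹ * x) ^ (p - 1) :=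
      Real.rpow_le_rpow hm.le h1 (by linarith)
    have h3 : (k⁻¹ * x) ^ (p - 1) * x = k⁻¹ ^ (p - 1) * x ^ p := by
      rw [Real.mul_rpow (by positivity) hx, mul_assoc, ← Real.rpow_add_one hx0.ne']
      congr 2; ring
    have h4 : 0 ≤ (p - 1) / 2 * m ^ p := by
      have := sub_pos.2 hp
      positivity
    calc p * m ^ (p - 1) * x = p * (m ^ (p - 1) * x) := by ring
      _ ≤ p * ((k⁻¹ * x) ^ (p - 1) * x) := by gcongr
      _ = p * k⁻¹ ^ (p - 1) * x ^ p := by rw [h3]; ring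
      _ ≤ _ := by linarith

/-- With t = y / x in [1, L] the left side is y^p (t^(2-p) - 1). Since 2 - p ≤ p, it is at most y^p
(t^p - 1) = t^p (y^p - x^p), and t^p ≤ L². This fixes the constant K = L² in the potential. -/
lemma sq_mul_rpow_sub_le {p L x y : ℝ} (hp : 1 < p) (hp2 : p ≤ 2) (hL : 1 ≤ L) (hx : 0 < x)
    (hxy : x ≤ y) (hy : y ≤ L * x) : y ^ 2 * x ^ (p - 2) - y ^ p ≤ L ^ 2 * (y ^ p - x ^ p) := by
  have hy0 : 0 < y := hx.trans_le hxy
  have h1 : 1 ≤ y / x := (one_le_div hx).2 hxy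
  have h2 : y / x ≤ L := (div_le_iff₀ hx).2 hy
  have e : y ^ 2 * x ^ (p - 2) = y ^ p * (y / x) ^ (2 - p) := by
    rw [Real.div_rpow hy0.le hx.le, ← mul_div_assoc, ← Real.rpow_add hy0,
      show p - 2 = -(2 - p) by ring, Real.rpow_neg hx.le, ← Real.rpow_natCast y 2]
    congr 2; push_cast; ring
  have h3 : (y / x) ^ (2 - p) ≤ (y / x) ^ p := Real.rpow_le_rpow_of_exponent_le h1 (by linarith)
  have h4 : (y / x) ^ p ≤ L ^ 2 := by
    rw [← Real.rpow_natCast]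
    calc (y / x) ^ p ≤ L ^ p := Real.rpow_le_rpow (by positivity) h2 (by linarith)
      _ ≤ _ := Real.rpow_le_rpow_of_exponent_le hL (by push_cast; exact hp2)
  have h5 : y ^ p = (y / x) ^ p * x ^ p := by
    rw [Real.div_rpow hy0.le hx.le]; field_simp
  have h6 : x ^ p ≤ y ^ p := Real.rpow_le_rpow hx.le hxy (by linarith)
  calc y ^ 2 * x ^ (p - 2) - y ^ p ≤ y ^ p * (y / x) ^ p - y ^ p := by rw [e]; gcongr
    _ = (y / x) ^ p * (y ^ p - x ^ p) := by
      nth_rewrite 2 [h5]; ring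
    _ ≤ L ^ 2 * (y ^ p - x ^ p) := by
      apply mul_le_mul_of_nonneg_right h4; linarith

/-- The tangent of t^p at m lies below the graph at x, which is Bernoulli's inequality for x / m. -/
lemma bernoulli_pow {p x m : ℝ} (hp : 1 < p) (hm : 0 < m) (hx : m ≤ x) :
    (p - 1) * x ^ p - p * x ^ (p - 1) * x ≤ (p - 1) * m ^ p - p * m ^ (p - 1) * x := by
  have hx0 := hm.trans_le hx
  have h := one_add_mul_self_le_rpow_one_add (s := x / m - 1)
    (by have : 0 ≤ x / m := by positivity
        linarith) hp.le
  rw [add_sub_cancel, Real.div_rpow hx0.le hm.le, le_div_iff₀ (by positivity)] at h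
  have e1 : m ^ p = m ^ (p - 1) * m := by
    rw [← Real.rpow_add_one hm.ne']; congr 1; ring
  have e2 : x ^ p = x ^ (p - 1) * x := by
    rw [← Real.rpow_add_one hx0.ne']; congr 1; ring
  have e3 : (1 + p * (x / m - 1)) * m ^ p = m ^ p - p * m ^ p + p * m ^ (p - 1) * x := by
    rw [e1]; field_simp; ring
  rw [e3] at h
  rw [show p * x ^ (p - 1) * x = p * x ^ p by rw [e2]; ring]
  linarith

/-- The Bellman function: a combination of Doob's maximal potential and weighted energies. -/
def bellmanFun (p A C K : ℝ) (F U P V H m : ℝ) : ℝ :=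
  A * ((p - 1) * m ^ p - p * m ^ (p - 1) * F + C * P) + H - U * m ^ (p - 2) - K * m ^ p -
    m ^ (2 - p) * V

/-- The crossover is at G = m^(p-1): below it m^(2-p) G² is at most m^p, above it at most G^q. The
exponents match because (p - 1)(q - 1) = 1. -/
lemma rpow_mul_le_of_sq {p q : ℝ} (hpq : p.HolderConjugate q) (hp2 : p ≤ 2) {G V H m : ℝ}
    (hm : 0 < m) (hG : 0 ≤ G) (hV : V ≤ G ^ 2) (hH : G ^ q ≤ H) :
    m ^ (2 - p) * V ≤ m ^ p + H := by
  have hm2 : 0 ≤ m ^ (2 - p) := by positivity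
  refine (mul_le_mul_of_nonneg_left hV hm2).trans ?_
  have hq0 := hpq.symm.pos
  have hmp : 0 < m ^ p := by positivity
  rcases le_or_gt G (m ^ (p - 1)) with h | h
  · have : m ^ (2 - p) * G ^ 2 ≤ m ^ p := by
      calc m ^ (2 - p) * G ^ 2 ≤ m ^ (2 - p) * (m ^ (p - 1)) ^ 2 := by gcongr
        _ = m ^ p := by
          rw [← Real.rpow_natCast (m ^ (p - 1)) 2, ← Real.rpow_mul hm.le, ← Real.rpow_add hm]
          congr 1; push_cast; ring
    have h0 : 0 ≤ G ^ q := by positivity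
    linarith
  · have hG0 : 0 < G := (by positivity : 0 < m ^ (p - 1)).trans h
    have h1 : m ≤ G ^ (q - 1) := by
      have := Real.rpow_le_rpow (by positivity) h.le (by linarith [hpq.symm.lt] : 0 ≤ q - 1)
      rw [← Real.rpow_mul hm.le] at this
      have e : (p - 1) * (q - 1) = 1 := by
        have := hpq.mul_eq_add; linarith
      rwa [e, Real.rpow_one] at this
    have : m ^ (2 - p) * G ^ 2 ≤ G ^ q := by
      calc m ^ (2 - p) * G ^ 2 ≤ (G ^ (q - 1)) ^ (2 - p) * G ^ 2 := by
            gcongr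
        _ = G ^ q := by
          rw [← Real.rpow_natCast G 2, ← Real.rpow_mul hG0.le, ← Real.rpow_add hG0]
          congr 1; push_cast
          have := hpq.mul_eq_add; linarith
    linarith

variable [Nonempty ι] {child : T → ι → T} {p q : ℝ} {F U P α G V H β : T → ℝ}

lemma child_le_card_mul (hF : ∀ Q, 0 ≤ F Q) (hFa : ∀ Q, childAvg child F Q = F Q) (Q : T) (e : ι) :
    F (child Q e) ≤ Fintype.card ι * F Q := by
  have h := hFa Q
  have hc : (0 : ℝ) < Fintype.card ι := by exact_mod_cast Fintype.card_pos
  rw [childAvg, div_eq_iff hc.ne', mul_comm] at h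
  rw [← h]
  exact Finset.single_le_sum (f := fun e => F (child Q e)) (fun e _ => hF _) (Finset.mem_univ e)

/-- Updating the running maximum does not raise the potential. Only the term -U m^(p-2) can grow
when m jumps to F, and the decrease of -K m^p pays for it because F ≤ L m; the Doob part and
-m^(2-p) V decrease by themselves. -/
lemma bellmanFun_child_le {p L A C K F U P V H m : ℝ} (hp : 1 < p) (hp2 : p ≤ 2) (hL : 1 ≤ L)
    (hA : 0 ≤ A) (hK : K = L ^ 2) (hm : 0 < m) (hU : U ≤ F ^ 2) (hV : 0 ≤ V)
    (hF : F ≤ L * m) :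
    bellmanFun p A C K F U P V H (max m F) ≤ bellmanFun p A C K F U P V H m := by
  rcases le_total F m with h | h
  · rw [max_eq_left h]
  rw [max_eq_right h]
  have hF1 : 0 < F := hm.trans_le h
  unfold bellmanFun
  have h1 := mul_le_mul_of_nonneg_left (bernoulli_pow hp hm h) hA
  have h2 : m ^ (2 - p) * V ≤ F ^ (2 - p) * V := by
    gcongr
  have h3 : U * m ^ (p - 2) - U * F ^ (p - 2) ≤ K * F ^ p - K * m ^ p := by
    have h4 := sq_mul_rpow_sub_le hp hp2 hL hm h hF
    have h5 : F ^ (p - 2) ≤ m ^ (p - 2) := Real.rpow_le_rpow_of_nonpos hm h (by linarith)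
    have e : F ^ p = F ^ 2 * F ^ (p - 2) := by
      rw [← Real.rpow_natCast F 2, ← Real.rpow_add hF1]; congr 1; push_cast; ring
    calc U * m ^ (p - 2) - U * F ^ (p - 2) = U * (m ^ (p - 2) - F ^ (p - 2)) := by ring
      _ ≤ F ^ 2 * (m ^ (p - 2) - F ^ (p - 2)) := by
        apply mul_le_mul_of_nonneg_right hU; linarith
      _ = F ^ 2 * m ^ (p - 2) - F ^ p := by rw [e]; ring
      _ ≤ _ := by rw [hK]; linarith
  linarith

/-- The Doob part is at least A (p - 1) / 2 · m^p = (K + 2) m^p. Of this, K m^p cancels the K-term,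
one m^p covers U m^(p-2), and the last one, together with H, covers m^(2-p) V. -/
lemma bellmanFun_nonneg {p q A C K F U P V H m G : ℝ} (hpq : p.HolderConjugate q) (hp2 : p ≤ 2)
    (hC0 : 0 ≤ C)
    (hC : ∀ m x : ℝ, 0 < m → 0 ≤ x → p * m ^ (p - 1) * x ≤ (p - 1) / 2 * m ^ p + C * x ^ p)
    (hA0 : 0 ≤ A) (hA : A * ((p - 1) / 2) = K + 2) (hm : 0 < m) (hF0 : 0 ≤ F) (hF : F ≤ m)
    (hU : U ≤ F ^ 2) (hP : F ^ p ≤ P) (hG : 0 ≤ G) (hV : V ≤ G ^ 2) (hH : G ^ q ≤ H) :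
    0 ≤ bellmanFun p A C K F U P V H m := by
  have h1 := hC m F hm hF0
  have h2 : C * F ^ p ≤ C * P := by gcongr
  have h3 : A * ((p - 1) / 2 * m ^ p) ≤
      A * ((p - 1) * m ^ p - p * m ^ (p - 1) * F + C * P) := by gcongr; linarith
  have h4 := rpow_mul_le_of_sq hpq hp2 hm hG hV hH
  have h5 : U * m ^ (p - 2) ≤ m ^ p := by
    have e : m ^ p = m ^ 2 * m ^ (p - 2) := by
      rw [← Real.rpow_natCast m 2, ← Real.rpow_add hm]; congr 1; push_cast; ring
    rw [e]
    gcongr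
    exact hU.trans (by gcongr)
  rw [← mul_assoc, hA] at h3
  unfold bellmanFun
  linarith

lemma bellmanFun_step (hp : 1 < p) (hp2 : p ≤ 2)
    (hf : IsAvgSystem child p F U P α) (hg : IsAvgSystem child q G V H β) {A C K : ℝ}
    (hA : 0 ≤ A) (hK : K = (Fintype.card ι : ℝ) ^ 2) {m : ℝ} (hm : 0 < m) (Q : T) (hF : F Q ≤ m) :
    α Q ^ 2 * m ^ (p - 2) + β Q ^ 2 * m ^ (2 - p) + childAvg child
      (fun R => bellmanFun p A C K (F R) (U R) (P R) (V R) (H R) (max m (F R))) Q ≤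
    bellmanFun p A C K (F Q) (U Q) (P Q) (V Q) (H Q) m := by
  have hL : (1 : ℝ) ≤ Fintype.card ι := by exact_mod_cast Fintype.card_pos
  have h1 : childAvg child
      (fun R => bellmanFun p A C K (F R) (U R) (P R) (V R) (H R) (max m (F R))) Q ≤
      childAvg child (fun R => bellmanFun p A C K (F R) (U R) (P R) (V R) (H R) m) Q := by
    refine childAvg_le_childAvg fun e => bellmanFun_child_le hp hp2 hL hA hK hm (hf.U_le _)
      (hg.U_nonneg _) ?_
    exact (child_le_card_mul hf.F_nonneg hf.F_avg Q e).trans (by gcongr)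
  -- For fixed m the potential is affine in the other variables. Averaging over children preserves
  -- F, P and H, so all the loss comes from the growth of U and V, which dominates α² and β².
  have h2 : childAvg child (fun R => bellmanFun p A C K (F R) (U R) (P R) (V R) (H R) m) Q =
      bellmanFun p A C K (F Q) (childAvg child U Q) (P Q) (childAvg child V Q) (H Q) m := by
    have e : (fun R => bellmanFun p A C K (F R) (U R) (P R) (V R) (H R) m) =
        fun R => (((((A * (p - 1) - K) * m ^ p + (-(A * p * m ^ (p - 1))) * F R) +
          (A * C) * P R) + H R) + (-(m ^ (p - 2))) * U R) + (-(m ^ (2 - p))) * V R := by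
      funext R; unfold bellmanFun; ring
    rw [e]
    simp only [childAvg_add, childAvg_const_mul, childAvg_const, hf.F_avg, hf.P_avg,
      hg.P_avg]
    unfold bellmanFun; ring
  have h3 := hf.α_sq_le Q
  have h4 := hg.α_sq_le Q
  have h5 : α Q ^ 2 * m ^ (p - 2) ≤ (childAvg child U Q - U Q) * m ^ (p - 2) := by gcongr
  have h6 : β Q ^ 2 * m ^ (2 - p) ≤ (childAvg child V Q - V Q) * m ^ (2 - p) := by gcongr
  rw [h2] at h1
  unfold bellmanFun at h1 ⊢
  linarith

/-- With w = m^(2-p) and w' = m'^(2-p), the product a b' is split with weight w and b a' with weight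
w'. Since w ≤ w' ≤ L w, changing to the weight belonging to each generation costs at most L, which
the division by L absorbs. -/
lemma mixed_le {p L m m' a b a' b' : ℝ} (hp2 : p ≤ 2) (hp : 1 < p) (hL : 1 ≤ L) (hm : 0 < m)
    (hmm : m ≤ m') (hm' : m' ≤ L * m) :
    (a * b' + b * a') / L ≤ (a ^ 2 * m ^ (p - 2) + b ^ 2 * m ^ (2 - p)) / 2 +
      (a' ^ 2 * m' ^ (p - 2) + b' ^ 2 * m' ^ (2 - p)) / 2 := by
  have hL0 : 0 < L := by linarith
  have hm0 := hm.trans_le hmm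
  have key : ∀ x y w : ℝ, 0 < w → x * y ≤ (x ^ 2 * w⁻¹ + y ^ 2 * w) / 2 := by
    intro x y w hw
    have : 0 ≤ (x - y * w) ^ 2 * w⁻¹ := by positivity
    have e : (x - y * w) ^ 2 * w⁻¹ = x ^ 2 * w⁻¹ + y ^ 2 * w - 2 * (x * y) := by
      field_simp; ring
    linarith
  have e1 : m ^ (p - 2) = (m ^ (2 - p))⁻¹ := by rw [← Real.rpow_neg hm.le]; congr 1; ring
  have e2 : m' ^ (p - 2) = (m' ^ (2 - p))⁻¹ := by rw [← Real.rpow_neg hm0.le]; congr 1; ring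
  set w := m ^ (2 - p) with hw
  set w' := m' ^ (2 - p) with hw'
  have w0 : 0 < w := by positivity
  have w0' : 0 < w' := by positivity
  have hww : w ≤ w' := Real.rpow_le_rpow hm.le hmm (by linarith)
  have hwL : w' ≤ L * w := by
    calc w' ≤ (L * m) ^ (2 - p) := Real.rpow_le_rpow hm0.le hm' (by linarith)
      _ = L ^ (2 - p) * w := Real.mul_rpow hL0.le hm.le
      _ ≤ L ^ (1 : ℝ) * w := by gcongr; linarith
      _ = _ := by rw [Real.rpow_one]
  rw [e1, e2, div_le_iff₀ hL0]
  have k1 := key a b' w w0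
  have k2 : b' ^ 2 * w ≤ b' ^ 2 * w' := by gcongr
  have k3 := key a' b w' w0'
  have k4 : b ^ 2 * w' ≤ L * (b ^ 2 * w) := by
    calc b ^ 2 * w' ≤ b ^ 2 * (L * w) := by gcongr
      _ = _ := by ring
  have p1 : 0 ≤ a ^ 2 * w⁻¹ := by positivity
  have p2 : 0 ≤ a' ^ 2 * w'⁻¹ := by positivity
  have p3 : 0 ≤ b' ^ 2 * w' := by positivity
  have p4 : 0 ≤ b ^ 2 * w := by positivity
  nlinarith

/-- Every node occurs in pairs with its children and in one pair with its parent, so its energy is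
shared: one half pays for the pairs below. The subtracted half on the right is reserved for the pair
with the parent and makes the induction close. -/
lemma mixedSum_le_bellmanFun (hpq : p.HolderConjugate q) (hp2 : p ≤ 2)
    (hf : IsAvgSystem child p F U P α) (hg : IsAvgSystem child q G V H β) {A C K : ℝ}
    (hC0 : 0 ≤ C)
    (hC : ∀ m x : ℝ, 0 < m → 0 ≤ x → p * m ^ (p - 1) * x ≤ (p - 1) / 2 * m ^ p + C * x ^ p)
    (hA0 : 0 ≤ A) (hA : A * ((p - 1) / 2) = K + 2) (hK : K = (Fintype.card ι : ℝ) ^ 2) (n : ℕ) :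
    ∀ (Q : T) (m : ℝ), 0 < m → F Q ≤ m → mixedSum child α β n Q / Fintype.card ι ≤
      bellmanFun p A C K (F Q) (U Q) (P Q) (V Q) (H Q) m -
        (α Q ^ 2 * m ^ (p - 2) + β Q ^ 2 * m ^ (2 - p)) / 2 := by
  have hL : (1 : ℝ) ≤ Fintype.card ι := by exact_mod_cast Fintype.card_pos
  have hL0 : (0 : ℝ) < Fintype.card ι := by linarith
  set L : ℝ := (Fintype.card ι : ℝ) with hLdef
  have hn : ∀ (R : T) (m : ℝ), 0 < m → F R ≤ m →
      0 ≤ bellmanFun p A C K (F R) (U R) (P R) (V R) (H R) m := fun R m hm hF =>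
    bellmanFun_nonneg hpq hp2 hC0 hC hA0 hA hm (hf.F_nonneg _) hF (hf.U_le _) (hf.F_pow_le _)
      (hg.F_nonneg _) (hg.U_le _) (hg.F_pow_le _)
  induction n with
  | zero =>
    intro Q m hm hF
    -- Even the empty sum needs a full step: nonnegativity at the children shows that the potential
    -- at Q dominates the whole energy of Q, hence the reserved half.
    have h := bellmanFun_step hpq.lt hp2 hf hg hA0 hK (C := C) hm Q hF
    have h2 : 0 ≤ childAvg child
        (fun R => bellmanFun p A C K (F R) (U R) (P R) (V R) (H R) (max m (F R))) Q :=
      div_nonneg (Finset.sum_nonneg fun e _ =>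
        hn _ _ (lt_max_of_lt_left hm) (le_max_right _ _)) hL0.le
    have h3 : 0 ≤ α Q ^ 2 * m ^ (p - 2) + β Q ^ 2 * m ^ (2 - p) := by positivity
    simp only [mixedSum, zero_div]
    linarith
  | succ n ih =>
    intro Q m hm hF
    have h := bellmanFun_step hpq.lt hp2 hf hg hA0 hK (C := C) hm Q hF
    set s : ℝ := (α Q ^ 2 * m ^ (p - 2) + β Q ^ 2 * m ^ (2 - p)) / 2 with hs
    let s' : T → ℝ := fun R =>
      (α R ^ 2 * (max m (F R)) ^ (p - 2) + β R ^ 2 * (max m (F R)) ^ (2 - p)) / 2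
    let Φ : T → ℝ := fun R => bellmanFun p A C K (F R) (U R) (P R) (V R) (H R) (max m (F R))
    have h1 : (∑ e, (α Q * β (child Q e) + β Q * α (child Q e))) / L / L ≤
        s + childAvg child s' Q := by
      have : (∑ e, (α Q * β (child Q e) + β Q * α (child Q e))) / L ≤
          ∑ e, (s + s' (child Q e)) := by
        rw [Finset.sum_div]
        refine Finset.sum_le_sum fun e _ => mixed_le hp2 hpq.lt hL hm (le_max_left _ _) ?_
        refine max_le (by nlinarith) ?_
        exact (child_le_card_mul hf.F_nonneg hf.F_avg Q e).trans (by gcongr)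
      calc _ ≤ (∑ e, (s + s' (child Q e))) / L := by gcongr
        _ = childAvg child (fun R => s + s' R) Q := rfl
        _ = _ := by rw [childAvg_add, childAvg_const]
    have h2 : childAvg child (mixedSum child α β n) Q / L ≤
        childAvg child Φ Q - childAvg child s' Q := by
      rw [← childAvg_sub, div_eq_inv_mul, ← childAvg_const_mul]
      refine childAvg_le_childAvg fun e => ?_
      rw [← div_eq_inv_mul]
      exact ih _ _ (lt_max_of_lt_left hm) (le_max_right _ _)
    rw [mixedSum, add_div]
    linarith

/-- The case `p ≤ 2` of the bilinear estimate for dyadic martingales. -/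
theorem exists_mixedSum_le_of_le_two (ι : Type*) [Fintype ι] [Nonempty ι] (hpq : p.HolderConjugate q)
    (hp2 : p ≤ 2) :
    ∃ D : ℝ, 0 ≤ D ∧ ∀ {T : Type} {child : T → ι → T} {F U P α G V H β : T → ℝ},
      IsAvgSystem child p F U P α → IsAvgSystem child q G V H β →
      ∀ n Q, mixedSum child α β n Q ≤ D * (P Q + H Q) := by
  obtain ⟨C, hC0, hC⟩ := exists_young_bound hpq.lt
  have hp1 := sub_pos.2 hpq.lt
  have hL : (1 : ℝ) ≤ Fintype.card ι := by exact_mod_cast Fintype.card_pos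
  set L : ℝ := (Fintype.card ι : ℝ) with hLdef
  set A : ℝ := (L ^ 2 + 2) / ((p - 1) / 2) with hA
  have hA0 : 0 ≤ A := by positivity
  refine ⟨L * (A * (p - 1) + A * C + 1), by positivity, ?_⟩
  intro T child F U P α G V H β hf hg n Q
  have hP : 0 ≤ P Q := (Real.rpow_nonneg (hf.F_nonneg _) _).trans (hf.F_pow_le Q)
  have hH : 0 ≤ H Q := (Real.rpow_nonneg (hg.F_nonneg _) _).trans (hg.F_pow_le Q)
  refine le_of_forall_pos_le_add fun δ hδ => ?_
  -- The initial maximum is chosen with m^p = P + η, which gives F ≤ m because F^p ≤ P. The η > 0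
  -- keeps m positive when P vanishes, and its contribution to the final bound is at most δ.
  set η : ℝ := δ / (L * (A * (p - 1)) + 1) with hη
  have hη0 : 0 < η := by positivity
  have hηδ : L * (A * (p - 1)) * η ≤ δ := by
    rw [hη, ← mul_div_assoc, div_le_iff₀ (by positivity)]; nlinarith
  set m : ℝ := (P Q + η) ^ p⁻¹ with hm
  have hm0 : 0 < m := by positivity
  have hmp : m ^ p = P Q + η := by
    rw [hm, ← Real.rpow_mul (by positivity), inv_mul_cancel₀ hpq.ne_zero, Real.rpow_one]
  have hF : F Q ≤ m := by
    rw [hm, Real.le_rpow_inv_iff_of_pos (hf.F_nonneg _) (by positivity) hpq.pos]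
    linarith [hf.F_pow_le Q]
  have h := mixedSum_le_bellmanFun hpq hp2 hf hg hC0 hC hA0
    (div_mul_cancel₀ _ (by positivity)) rfl n Q m hm0 hF
  rw [div_le_iff₀ (by linarith)] at h
  have h1 : bellmanFun p A C (L ^ 2) (F Q) (U Q) (P Q) (V Q) (H Q) m -
        (α Q ^ 2 * m ^ (p - 2) + β Q ^ 2 * m ^ (2 - p)) / 2 ≤
      A * (p - 1) * (P Q + η) + A * C * P Q + H Q := by
    unfold bellmanFun
    have a1 : 0 ≤ A * (p * m ^ (p - 1) * F Q) := by
      have := hf.F_nonneg Q; have := hpq.pos; positivity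
    have a2 : 0 ≤ U Q * m ^ (p - 2) := by have := hf.U_nonneg Q; positivity
    have a3 : 0 ≤ m ^ (2 - p) * V Q := by have := hg.U_nonneg Q; positivity
    have a4 : 0 ≤ L ^ 2 * m ^ p := by positivity
    have a5 : 0 ≤ (α Q ^ 2 * m ^ (p - 2) + β Q ^ 2 * m ^ (2 - p)) / 2 := by positivity
    rw [← hmp]
    nlinarith
  have h2 := h.trans (mul_le_mul_of_nonneg_right h1 (by linarith : 0 ≤ L))
  have : 0 ≤ L * (A * (p - 1)) * H Q := by positivity
  have : 0 ≤ L * (A * C) * H Q := by positivity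
  have : 0 ≤ L * P Q := by positivity
  nlinarith

/-- The bilinear estimate for dyadic martingales: mixed sums of square-function terms of `f ∈ L^p`
and `g ∈ L^q` are controlled by the averages of `|f|^p` and `|g|^q`. -/
theorem exists_mixedSum_le (ι : Type*) [Fintype ι] [Nonempty ι] (hpq : p.HolderConjugate q) :
    ∃ D : ℝ, 0 ≤ D ∧ ∀ {T : Type} {child : T → ι → T} {F U P α G V H β : T → ℝ},
      IsAvgSystem child p F U P α → IsAvgSystem child q G V H β →
      ∀ n Q, mixedSum child α β n Q ≤ D * (P Q + H Q) := by
  rcases le_total p 2 with hp | hp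
  · exact exists_mixedSum_le_of_le_two ι hpq hp
  · have hq : q ≤ 2 := by
      have := hpq.mul_eq_add
      have := hpq.symm.pos
      nlinarith
    obtain ⟨D, hD, h⟩ := exists_mixedSum_le_of_le_two ι hpq.symm hq
    refine ⟨D, hD, fun hf hg n Q => ?_⟩
    rw [mixedSum_comm, add_comm]
    exact h hg hf n Q

end Tree

/-! ### Children of dyadic cubes -/

section Cubes

variable {d : ℕ} (G : DyadicGrid d)

/-- The label of a dyadic child of a cube. -/
def child (Q : CubeIndex d) (e : Fin d → Fin 2) : CubeIndex d :=
  (Q.1 - 1, fun i => 2 * Q.2 i + ((e i : ℕ) : ℤ))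

lemma DyadicGrid.side_child (Q : CubeIndex d) (e : Fin d → Fin 2) :
    G.side (child Q e) = G.side Q / 2 := by
  simp only [DyadicGrid.side, child, zpow_sub_one₀ (two_ne_zero' ℝ)]
  ring

lemma DyadicGrid.left_child (Q : CubeIndex d) (e : Fin d → Fin 2) (i : Fin d) :
    G.left (child Q e) i = G.left Q i + (e i : ℕ) * (G.side Q / 2) := by
  simp only [DyadicGrid.left, DyadicGrid.side, child, zpow_sub_one₀ (two_ne_zero' ℝ)]
  push_cast
  ring

lemma DyadicGrid.mem_cube {Q : CubeIndex d} {x : Fin d → ℝ} :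
    x ∈ G.cube Q ↔ ∀ i, G.left Q i ≤ x i ∧ x i < G.left Q i + G.side Q := by
  simp [DyadicGrid.cube]

lemma DyadicGrid.measurableSet_cube (Q : CubeIndex d) : MeasurableSet (G.cube Q) :=
  MeasurableSet.univ_pi fun _ => measurableSet_Ico

lemma DyadicGrid.volume_cube (Q : CubeIndex d) :
    volume (G.cube Q) = ENNReal.ofReal (G.side Q ^ d) := by
  rw [DyadicGrid.cube, Real.volume_pi_Ico]
  simp [ENNReal.ofReal_pow (G.side_pos Q).le]

lemma DyadicGrid.volume_real_cube (Q : CubeIndex d) : volume.real (G.cube Q) = G.side Q ^ d := by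
  rw [measureReal_def, G.volume_cube, ENNReal.toReal_ofReal (pow_pos (G.side_pos Q) _).le]

lemma DyadicGrid.volume_cube_lt_top (Q : CubeIndex d) : volume (G.cube Q) < ∞ := by
  rw [G.volume_cube]; exact ENNReal.ofReal_lt_top

lemma DyadicGrid.volume_cube_ne_zero (Q : CubeIndex d) : volume (G.cube Q) ≠ 0 := by
  rw [G.volume_cube, ne_eq, ENNReal.ofReal_eq_zero, not_le]
  exact pow_pos (G.side_pos Q) _

/-- Every point lies in exactly one cube of each generation. -/
lemma DyadicGrid.mem_cube_iff_floor {k : ℤ} {j : Fin d → ℤ} {x : Fin d → ℝ} :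
    x ∈ G.cube (k, j) ↔
      j = fun i => ⌊(x i / G.scale - G.shift i) / (2 : ℝ) ^ k⌋ := by
  have ha : 0 < G.scale := by linarith [G.one_le_scale]
  have hK : (0 : ℝ) < 2 ^ k := zpow_pos two_pos _
  rw [G.mem_cube, funext_iff]
  refine forall_congr' fun i => ?_
  rw [eq_comm, Int.floor_eq_iff, le_div_iff₀ hK, div_lt_iff₀ hK, le_sub_iff_add_le,
    sub_lt_iff_lt_add, le_div_iff₀ ha, div_lt_iff₀ ha]
  simp only [DyadicGrid.left, DyadicGrid.side]
  constructor <;> rintro ⟨h1, h2⟩ <;> constructor <;> linarith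

lemma DyadicGrid.disjoint_cube {k : ℤ} {j j' : Fin d → ℤ} (h : j ≠ j') :
    Disjoint (G.cube (k, j)) (G.cube (k, j')) := by
  rw [Set.disjoint_left]
  intro x h1 h2
  rw [G.mem_cube_iff_floor] at h1 h2
  exact h (h1.trans h2.symm)

lemma child_injective (Q : CubeIndex d) : Function.Injective (child Q) := by
  intro e e' h
  funext i
  have h1 := congrFun (congrArg Prod.snd h) i
  simp only [child] at h1
  omega

lemma DyadicGrid.pairwise_disjoint_child (Q : CubeIndex d) :
    Pairwise (Function.onFun Disjoint fun e => G.cube (child Q e)) := by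
  intro e e' h
  refine G.disjoint_cube fun hj => h (child_injective Q (Prod.ext rfl hj))

lemma DyadicGrid.cube_child_subset (Q : CubeIndex d) (e : Fin d → Fin 2) :
    G.cube (child Q e) ⊆ G.cube Q := by
  intro x hx
  rw [G.mem_cube] at hx ⊢
  intro i
  have h := hx i
  have hs := G.side_pos Q
  rw [G.left_child, G.side_child] at h
  have h0 : (0 : ℝ) ≤ ((e i : ℕ) : ℝ) := Nat.cast_nonneg _
  have h1 : ((e i : ℕ) : ℝ) ≤ 1 := by exact_mod_cast Nat.le_of_lt_succ (e i).2
  constructor <;> nlinarith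

lemma DyadicGrid.cube_eq_iUnion_child (Q : CubeIndex d) :
    G.cube Q = ⋃ e, G.cube (child Q e) := by
  refine Set.Subset.antisymm (fun x hx => ?_) (Set.iUnion_subset fun e => G.cube_child_subset Q e)
  rw [G.mem_cube] at hx
  refine Set.mem_iUnion.2 ⟨fun i => if x i < G.left Q i + G.side Q / 2 then 0 else 1, ?_⟩
  rw [G.mem_cube]
  intro i
  have h := hx i
  rw [G.left_child, G.side_child]
  split_ifs with hc
  · simp only [Fin.val_zero, Nat.cast_zero]
    constructor <;> linarith
  · simp only [Fin.val_one, Nat.cast_one]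
    push Not at hc
    constructor <;> linarith

lemma DyadicGrid.volume_real_child (Q : CubeIndex d) (e : Fin d → Fin 2) :
    volume.real (G.cube (child Q e)) = volume.real (G.cube Q) / 2 ^ d := by
  rw [G.volume_real_cube, G.volume_real_cube, G.side_child, div_pow]

/-- The image of a cube under the cube map of a Haar shift is one of its children. -/
lemma ShiftData.exists_onCube_eq_child {G : DyadicGrid d} (σ : ShiftData G) (hd : 1 ≤ d)
    (Q : CubeIndex d) : ∃ e, σ.onCube Q = child Q e := by
  have hs := G.side_pos Q
  have hs' := G.side_pos (σ.onCube Q)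
  have h1 : (2 * G.side (σ.onCube Q)) ^ d = G.side Q ^ d := by
    have h := σ.volume_cube Q
    rw [G.volume_cube, G.volume_cube, show (2 : ℝ≥0∞) ^ d = ENNReal.ofReal (2 ^ d) by
      rw [ENNReal.ofReal_pow zero_le_two]; simp, ← ENNReal.ofReal_mul (by positivity),
      ENNReal.ofReal_eq_ofReal_iff (by positivity) (by positivity)] at h
    rw [mul_pow]; exact h
  have h2 : 2 * G.side (σ.onCube Q) = G.side Q :=
    (pow_left_inj₀ (by positivity) hs.le (by omega)).1 h1
  have hk : (σ.onCube Q).1 = Q.1 - 1 := by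
    have ha : G.scale ≠ 0 := by linarith [G.one_le_scale]
    have h3 : (2 : ℝ) ^ ((σ.onCube Q).1 + 1) = 2 ^ Q.1 := by
      rw [zpow_add_one₀ two_ne_zero]
      simp only [DyadicGrid.side] at h2
      apply mul_left_cancel₀ ha
      linarith
    have := zpow_right_injective₀ (zero_lt_two' ℝ) (by norm_num) h3
    omega
  -- The lower corner of σ(Q) lies in some child of Q. That child and σ(Q) are of the same
  -- generation, where a point determines its cube through the floor formula.
  have hx : G.left (σ.onCube Q) ∈ G.cube (σ.onCube Q) := by
    rw [G.mem_cube]; intro i; constructor <;> linarith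
  have hx2 := σ.cube_subset Q hx
  rw [G.cube_eq_iUnion_child, Set.mem_iUnion] at hx2
  obtain ⟨e, he⟩ := hx2
  refine ⟨e, Prod.ext hk ?_⟩
  rw [show σ.onCube Q = ((child Q e).1, (σ.onCube Q).2) from Prod.ext hk rfl,
    G.mem_cube_iff_floor] at hx
  have he' : G.left ((child Q e).1, (σ.onCube Q).2) ∈ G.cube ((child Q e).1, (child Q e).2) := by
    rw [show ((child Q e).1, (σ.onCube Q).2) = σ.onCube Q from Prod.ext hk.symm rfl]
    exact he
  rw [G.mem_cube_iff_floor] at he'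
  exact hx.trans he'.symm

/-! ### Averages over dyadic cubes -/

variable {E : Type*} [NormedAddCommGroup E] [NormedSpace ℝ E]

/-- The average of a function over a cube of the grid. -/
def cubeAvg (f : (Fin d → ℝ) → E) (Q : CubeIndex d) : E :=
  (volume.real (G.cube Q))⁻¹ • ∫ x in G.cube Q, f x

lemma DyadicGrid.volume_real_pos (Q : CubeIndex d) : 0 < volume.real (G.cube Q) := by
  rw [G.volume_real_cube]; exact pow_pos (G.side_pos Q) _

lemma volume_smul_cubeAvg (f : (Fin d → ℝ) → E) (Q : CubeIndex d) :
    volume.real (G.cube Q) • cubeAvg G f Q = ∫ x in G.cube Q, f x := by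
  rw [cubeAvg, smul_inv_smul₀ (G.volume_real_pos Q).ne']

lemma setIntegral_cube_eq_sum {f : (Fin d → ℝ) → E} (hf : Integrable f) (Q : CubeIndex d) :
    ∫ x in G.cube Q, f x = ∑ e, ∫ x in G.cube (child Q e), f x := by
  rw [G.cube_eq_iUnion_child, integral_iUnion_fintype (fun e => G.measurableSet_cube _)
    (G.pairwise_disjoint_child Q) (fun e => hf.integrableOn)]

lemma sum_cubeAvg_child {f : (Fin d → ℝ) → E} (hf : Integrable f) (Q : CubeIndex d) :
    ∑ e, cubeAvg G f (child Q e) = (2 ^ d : ℝ) • cubeAvg G f Q := by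
  have hV := G.volume_real_pos Q
  simp only [cubeAvg, G.volume_real_child, ← Finset.smul_sum]
  rw [setIntegral_cube_eq_sum G hf, smul_smul]
  congr 1
  field_simp

lemma card_children : (Fintype.card (Fin d → Fin 2) : ℝ) = 2 ^ d := by
  simp

lemma childAvg_cubeAvg {f : (Fin d → ℝ) → ℝ} (hf : Integrable f) (Q : CubeIndex d) :
    childAvg child (cubeAvg G f) Q = cubeAvg G f Q := by
  rw [childAvg, sum_cubeAvg_child G hf, card_children, smul_eq_mul]
  field_simp

/-- The mean oscillation of the averages of a function over the children of a cube. -/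
def cubeOsc (f : (Fin d → ℝ) → E) (Q : CubeIndex d) : ℝ :=
  (∑ e, ‖cubeAvg G f (child Q e) - cubeAvg G f Q‖) / 2 ^ d

lemma cubeOsc_nonneg (f : (Fin d → ℝ) → E) (Q : CubeIndex d) : 0 ≤ cubeOsc G f Q := by
  unfold cubeOsc; positivity

variable {𝕜 : Type*} [RCLike 𝕜]

/-- Cauchy–Schwarz over the 2^d children, followed by the variance identity: the cross term is
evaluated by the fact that the child averages have mean equal to the average over Q. -/
lemma cubeOsc_sq_le {f : (Fin d → ℝ) → 𝕜} (hf : Integrable f) (Q : CubeIndex d) :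
    cubeOsc G f Q ^ 2 ≤
      childAvg child (fun R => ‖cubeAvg G f R‖ ^ 2) Q - ‖cubeAvg G f Q‖ ^ 2 := by
  have h1 := sq_sum_le_card_mul_sum_sq (s := Finset.univ)
    (f := fun e => ‖cubeAvg G f (child Q e) - cubeAvg G f Q‖)
  rw [Finset.card_univ, card_children] at h1
  have h2 : ∑ e, ‖cubeAvg G f (child Q e) - cubeAvg G f Q‖ ^ 2 =
      ∑ e, ‖cubeAvg G f (child Q e)‖ ^ 2 - 2 ^ d * ‖cubeAvg G f Q‖ ^ 2 := by
    have h3 : ∑ e, RCLike.re (inner 𝕜 (cubeAvg G f (child Q e)) (cubeAvg G f Q)) =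
        2 ^ d * ‖cubeAvg G f Q‖ ^ 2 := by
      rw [← map_sum, ← sum_inner, sum_cubeAvg_child G hf,
        RCLike.real_smul_eq_coe_smul (K := 𝕜), inner_smul_left, RCLike.conj_ofReal,
        RCLike.re_ofReal_mul, inner_self_eq_norm_sq]
    simp only [@norm_sub_sq 𝕜]
    rw [Finset.sum_add_distrib, Finset.sum_sub_distrib, ← Finset.mul_sum, h3, Finset.sum_const,
      Finset.card_univ, nsmul_eq_mul, card_children]
    ring
  rw [cubeOsc, childAvg, card_children, div_pow, div_le_iff₀ (by positivity)]
  rw [h2] at h1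
  calc _ ≤ _ := h1
    _ = _ := by field_simp

lemma cubeAvg_norm_rpow_le {f : (Fin d → ℝ) → 𝕜} {p : ℝ} (hp : 1 ≤ p) (hf : Integrable f)
    (hfp : Integrable fun x => ‖f x‖ ^ p) (Q : CubeIndex d) :
    cubeAvg G (fun x => ‖f x‖) Q ^ p ≤ cubeAvg G (fun x => ‖f x‖ ^ p) Q := by
  have h := (convexOn_rpow hp).map_set_average_le (μ := volume) (t := G.cube Q)
    (f := fun x => ‖f x‖) ((Real.continuous_rpow_const (by linarith)).continuousOn) isClosed_Ici
    (G.volume_cube_ne_zero Q) (G.volume_cube_lt_top Q).ne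
    (.of_forall fun x => norm_nonneg (f x)) hf.norm.integrableOn hfp.integrableOn
  simpa only [setAverage_eq, cubeAvg] using h

lemma isAvgSystem {f : (Fin d → ℝ) → 𝕜} {p : ℝ} (hp : 1 ≤ p) (hf : Integrable f)
    (hfp : Integrable fun x => ‖f x‖ ^ p) :
    IsAvgSystem child p (cubeAvg G fun x => ‖f x‖) (fun Q => ‖cubeAvg G f Q‖ ^ 2)
      (cubeAvg G fun x => ‖f x‖ ^ p) (cubeOsc G f) where
  F_nonneg Q := smul_nonneg (by positivity) (integral_nonneg fun x => norm_nonneg _)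
  F_avg := childAvg_cubeAvg G hf.norm
  U_nonneg Q := by positivity
  U_le Q := by
    gcongr
    rw [cubeAvg, cubeAvg, norm_smul, Real.norm_of_nonneg (by positivity), smul_eq_mul]
    gcongr
    exact norm_integral_le_integral_norm _
  P_avg := childAvg_cubeAvg G hfp
  F_pow_le := cubeAvg_norm_rpow_le G hp hf hfp
  α_nonneg := cubeOsc_nonneg G f
  α_sq_le := cubeOsc_sq_le G hf

end Cubes

/-! ### Haar coefficients and mean oscillation -/

section HaarCoefficients

variable {d : ℕ} (G : DyadicGrid d) {𝕜 : Type*} [RCLike 𝕜]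

/-- The interior of a cube of the grid. -/
def DyadicGrid.openCube (Q : CubeIndex d) : Set (Fin d → ℝ) :=
  Set.univ.pi fun i => Set.Ioo (G.left Q i) (G.left Q i + G.side Q)

lemma DyadicGrid.openCube_ae_eq (Q : CubeIndex d) : G.openCube Q =ᵐ[volume] G.cube Q :=
  Measure.univ_pi_Ioo_ae_eq_Icc.trans Measure.univ_pi_Ico_ae_eq_Icc.symm

lemma DyadicGrid.measurableSet_openCube (Q : CubeIndex d) : MeasurableSet (G.openCube Q) :=
  MeasurableSet.univ_pi fun _ => measurableSet_Ioo

/-- The jumps of a factor sit at the ends and the midpoint of a side, never inside a side of a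
child. Open cubes are needed because h¹ vanishes at the left end of its interval. -/
lemma haarReal_eq_of_mem_openCube_child (q : CubeIndex d × Sig d) (e : Fin d → Fin 2)
    {x y : Fin d → ℝ} (hx : x ∈ G.openCube (child q.1 e)) (hy : y ∈ G.openCube (child q.1 e)) :
    haarReal G q x = haarReal G q y := by
  refine Finset.prod_congr rfl fun i _ => ?_
  have hs := G.side_pos q.1
  obtain ⟨v, hv⟩ := haarInterval_const (q.2.1 i) (G.left q.1 i) hs
    (G.left (child q.1 e) i) (G.left (child q.1 e) i + G.side (child q.1 e))
    (by
      left; rw [G.left_child]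
      have : 0 ≤ ((e i : ℕ) : ℝ) * (G.side q.1 / 2) := by positivity
      linarith)
    (by
      rw [G.left_child, G.side_child]
      rcases (by omega : e i = 0 ∨ e i = 1) with h | h <;> rw [h]
      · right; simp
      · left; simp)
    (by
      right; rw [G.left_child, G.side_child]
      rcases (by omega : e i = 0 ∨ e i = 1) with h | h <;> rw [h] <;> simp <;> linarith)
  rw [hv _ (hx i trivial), hv _ (hy i trivial)]

lemma haarReal_abs_le_side (q : CubeIndex d × Sig d) (x : Fin d → ℝ) :
    |haarReal G q x| ≤ (G.side q.1 ^ (-(1 / 2) : ℝ)) ^ d := by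
  have hs := G.side_pos q.1
  rw [haarReal, Finset.abs_prod]
  calc _ ≤ ∏ _i : Fin d, G.side q.1 ^ (-(1 / 2) : ℝ) := by
        refine Finset.prod_le_prod (fun _ _ => abs_nonneg _) fun i _ => ?_
        rw [haarInterval, abs_mul, abs_of_nonneg (by positivity)]
        exact mul_le_of_le_one_right (by positivity) (haarMother_abs_le _ _)
    _ = _ := by simp

lemma exists_haarReal_values (q : CubeIndex d × Sig d) :
    ∃ v : (Fin d → Fin 2) → ℝ, (∀ e, |v e| ≤ (G.side q.1 ^ (-(1 / 2) : ℝ)) ^ d) ∧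
      ∀ e, ∀ x ∈ G.openCube (child q.1 e), haarReal G q x = v e := by
  refine ⟨fun e => haarReal G q fun i => G.left (child q.1 e) i + G.side (child q.1 e) / 2,
    fun e => haarReal_abs_le_side G q _, fun e x hx =>
    haarReal_eq_of_mem_openCube_child G q e hx fun i _ => ?_⟩
  have hs := G.side_pos (child q.1 e)
  exact ⟨by linarith, by linarith⟩

lemma IsBddFun.integrable {f : (Fin d → ℝ) → 𝕜} (hf : IsBddFun f) : Integrable f := by
  obtain ⟨mf, ⟨C, hC⟩, bf⟩ := hf
  have h : IntegrableOn f (Function.support f) :=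
    Measure.integrableOn_of_bounded bf.measure_lt_top.ne mf.aestronglyMeasurable (.of_forall hC)
  exact (integrableOn_iff_integrable_of_support_subset subset_rfl).1 h

lemma haarReal_integrable (q : CubeIndex d × Sig d) : Integrable (haarReal G q) := by
  have e : haarReal G q = haar ℝ G q := by funext x; simp [haar]
  rw [e]
  exact (haar_isBddFun (𝕜 := ℝ) G q).integrable

lemma haarReal_integral (q : CubeIndex d × Sig d) : ∫ x, haarReal G q x = 0 := by
  have h : ∫ x, haarReal G q x = ∏ i, ∫ x, haarInterval (q.2.1 i)
      (G.left q.1 i + G.side q.1 / 2) (G.side q.1) x :=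
    integral_fintype_prod_volume_eq_prod (𝕜 := ℝ) (fun i x =>
      haarInterval (q.2.1 i) (G.left q.1 i + G.side q.1 / 2) (G.side q.1) x)
  obtain ⟨i, hi⟩ : ∃ i, q.2.1 i ≠ 1 := by
    by_contra! hc
    exact q.2.2 (funext hc)
  have hi0 : q.2.1 i = 0 := by omega
  rw [h]
  refine Finset.prod_eq_zero (Finset.mem_univ i) ?_
  have := haarInterval_mul_integral (G.left q.1 i) (G.side_pos q.1) (fun _ => 1) 1
    (fun _ _ => rfl)
  rw [hi0]
  simpa using this

lemma haar_mul_integrable {f : (Fin d → ℝ) → 𝕜} (hf : Integrable f) (q : CubeIndex d × Sig d) :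
    Integrable fun x => haar 𝕜 G q x * f x := by
  refine hf.bdd_mul (c := (G.side q.1 ^ (-(1 / 2) : ℝ)) ^ d)
    (haar_isBddFun G q).1.aestronglyMeasurable (.of_forall fun x => ?_)
  simpa [haar] using haarReal_abs_le_side G q x

lemma integral_haar_mul_eq_sum {q : CubeIndex d × Sig d} {v : (Fin d → Fin 2) → ℝ}
    (hv : ∀ e, ∀ x ∈ G.openCube (child q.1 e), haarReal G q x = v e)
    {f : (Fin d → ℝ) → 𝕜} (hf : Integrable fun x => haar 𝕜 G q x * f x) :
    ∫ x, haar 𝕜 G q x * f x = ∑ e, (v e : 𝕜) * ∫ x in G.cube (child q.1 e), f x := by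
  have h1 : ∫ x, haar 𝕜 G q x * f x = ∫ x in G.cube q.1, haar 𝕜 G q x * f x := by
    refine (setIntegral_eq_integral_of_forall_compl_eq_zero fun x hx => ?_).symm
    simp [haar, haarReal_eq_zero G q x hx]
  rw [h1, setIntegral_cube_eq_sum G hf]
  refine Finset.sum_congr rfl fun e _ => ?_
  rw [← integral_const_mul, ← setIntegral_congr_set (G.openCube_ae_eq _),
    ← setIntegral_congr_set (G.openCube_ae_eq _)]
  exact setIntegral_congr_fun (G.measurableSet_openCube _) fun x hx => by
    simp only [haar, hv e x hx]

/-- The children have equal volume, so this is the vanishing of the integral of the Haar function.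
-/
lemma sum_haarReal_values_eq_zero {q : CubeIndex d × Sig d} {v : (Fin d → Fin 2) → ℝ}
    (hv : ∀ e, ∀ x ∈ G.openCube (child q.1 e), haarReal G q x = v e) : ∑ e, v e = 0 := by
  have h := integral_haar_mul_eq_sum (𝕜 := ℝ) G hv (f := fun _ => 1)
    (by simpa [haar] using haarReal_integrable G q)
  simp only [haar, mul_one, RCLike.ofReal_real_eq_id, id_eq, haarReal_integral,
    setIntegral_const, G.volume_real_child, smul_eq_mul, mul_one, ← Finset.sum_mul] at h
  rcases mul_eq_zero.1 h.symm with h | h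
  · exact h
  · have := G.volume_real_pos q.1
    exact absurd h (by positivity)

/-- A Haar coefficient is controlled by the mean oscillation. -/
lemma norm_integral_haar_mul_le {f : (Fin d → ℝ) → 𝕜} (hf : Integrable f)
    (q : CubeIndex d × Sig d) :
    ‖∫ x, haar 𝕜 G q x * f x‖ ≤
      (G.side q.1 ^ (-(1 / 2) : ℝ)) ^ d * (volume.real (G.cube q.1) * cubeOsc G f q.1) := by
  obtain ⟨v, hv0, hv⟩ := exists_haarReal_values G q
  have hV := G.volume_real_pos q.1
  have h0 : ∑ e, (v e : 𝕜) = 0 := by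
    rw [← RCLike.ofReal_sum, sum_haarReal_values_eq_zero G hv, RCLike.ofReal_zero]
  -- Because the values v e sum to zero, the average over the whole cube can be subtracted from each
  -- child average.
  have h1 : ∫ x, haar 𝕜 G q x * f x = ∑ e, (v e : 𝕜) * ((volume.real (G.cube q.1) / 2 ^ d) •
      (cubeAvg G f (child q.1 e) - cubeAvg G f q.1)) := by
    rw [integral_haar_mul_eq_sum G hv (haar_mul_integrable G hf q)]
    simp only [smul_sub, mul_sub, Finset.sum_sub_distrib, ← Finset.sum_mul, h0, zero_mul, sub_zero]
    refine Finset.sum_congr rfl fun e _ => ?_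
    rw [← volume_smul_cubeAvg, G.volume_real_child]
  rw [h1]
  refine (norm_sum_le _ _).trans ?_
  rw [cubeOsc, ← mul_div_assoc, ← mul_div_assoc, Finset.mul_sum, Finset.mul_sum, Finset.sum_div]
  refine Finset.sum_le_sum fun e _ => ?_
  rw [norm_mul, norm_smul, RCLike.norm_ofReal, Real.norm_of_nonneg (by positivity), mul_div_assoc,
    div_mul_eq_mul_div]
  gcongr
  exact hv0 e

end HaarCoefficients

/-! ### One-parameter Haar shifts on `L^p` -/

section OneParameter

variable {d : ℕ} (G : DyadicGrid d) {𝕜 : Type*} [RCLike 𝕜]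

/-- The descendants of a cube in the first `n` generations, including the cube itself. -/
def descendants : ℕ → CubeIndex d → Finset (CubeIndex d)
  | 0, _ => ∅
  | n + 1, Q => {Q} ∪ Finset.univ.biUnion fun e => descendants n (child Q e)

/-- Floor division of the label by 2^m yields the m-th ancestor. The inequality is strict because
the root counts among the n generations. -/
lemma mem_descendants (m : ℕ) : ∀ (n : ℕ) (k : ℤ) (j : Fin d → ℤ), m < n →
    (k, j) ∈ descendants n (k + m, fun i => j i / 2 ^ m) := by
  induction m with
  | zero =>
    intro n k j h
    obtain ⟨n, rfl⟩ : ∃ n', n = n' + 1 := ⟨n - 1, by omega⟩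
    simp [descendants]
  | succ m ih =>
    intro n k j h
    obtain ⟨n, rfl⟩ : ∃ n', n = n' + 1 := ⟨n - 1, by omega⟩
    rw [descendants, Finset.mem_union]
    right
    rw [Finset.mem_biUnion]
    -- The path from the root goes through the m-th ancestor, whose position inside its parent is
    -- the parity of its label.
    refine ⟨fun i => if (j i / 2 ^ m) % 2 = 0 then 0 else 1, Finset.mem_univ _, ?_⟩
    convert ih n k j (by omega) using 1
    refine congrArg _ (Prod.ext (by simp only [child]; push_cast; ring) (funext fun i => ?_))
    simp only [child]
    rw [pow_succ, ← Int.ediv_ediv_of_nonneg (by positivity)]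
    split_ifs with hc
    · simp only [Fin.val_zero]; omega
    · simp only [Fin.val_one]; omega

lemma sum_union_le_of_nonneg {X : Type*} [DecidableEq X] {w : X → ℝ} (hw : ∀ x, 0 ≤ w x)
    (A B : Finset X) : ∑ x ∈ A ∪ B, w x ≤ ∑ x ∈ A, w x + ∑ x ∈ B, w x := by
  rw [← Finset.sum_union_inter]
  exact le_add_of_nonneg_right (Finset.sum_nonneg fun x _ => hw x)

lemma sum_biUnion_le_of_nonneg {X Y : Type*} [DecidableEq X] [DecidableEq Y] {w : X → ℝ}
    (hw : ∀ x, 0 ≤ w x) (s : Finset Y) (A : Y → Finset X) :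
    ∑ x ∈ s.biUnion A, w x ≤ ∑ y ∈ s, ∑ x ∈ A y, w x := by
  induction s using Finset.induction_on with
  | empty => simp
  | insert y s hy ih =>
    rw [Finset.biUnion_insert, Finset.sum_insert hy]
    exact (sum_union_le_of_nonneg hw _ _).trans (by gcongr)

/-- The factor 2^d undoes the division by the number of children in the top term of `mixedSum`.
Further down, the smaller volumes of the children match the averages, so no factor accumulates with
n. -/
lemma sum_descendants_le {w α β : CubeIndex d → ℝ} (hw : ∀ Q, 0 ≤ w Q)
    (h : ∀ Q, w Q ≤ volume.real (G.cube Q) *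
      ∑ e, (α Q * β (child Q e) + β Q * α (child Q e))) (n : ℕ) :
    ∀ Q, ∑ R ∈ descendants n Q, w R ≤ 2 ^ d * (volume.real (G.cube Q) * mixedSum child α β n Q) := by
  induction n with
  | zero => intro Q; simp [descendants, mixedSum]
  | succ n ih =>
    intro Q
    rw [descendants, mixedSum, childAvg, card_children]
    have h1 : ∑ R ∈ {Q} ∪ Finset.univ.biUnion (fun e => descendants n (child Q e)), w R ≤
        w Q + ∑ e, ∑ R ∈ descendants n (child Q e), w R := by
      refine (sum_union_le_of_nonneg hw _ _).trans ?_
      rw [Finset.sum_singleton]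
      gcongr
      exact sum_biUnion_le_of_nonneg hw _ _
    refine h1.trans ?_
    have h2 : ∑ e, ∑ R ∈ descendants n (child Q e), w R ≤
        volume.real (G.cube Q) * ∑ e, mixedSum child α β n (child Q e) := by
      rw [Finset.mul_sum]
      refine Finset.sum_le_sum fun e _ => (ih _).trans_eq ?_
      rw [G.volume_real_child]
      field_simp
    have h3 := h Q
    rw [← add_div]
    refine (add_le_add h3 h2).trans_eq ?_
    field_simp

/-- Cubes of one generation are disjoint, so the tree estimates at different roots add up to a
global one. -/
lemma sum_volume_mul_cubeAvg_le {h : (Fin d → ℝ) → ℝ} (h0 : ∀ x, 0 ≤ h x) (hi : Integrable h)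
    (K : ℤ) (J : Finset (Fin d → ℤ)) :
    ∑ j ∈ J, volume.real (G.cube (K, j)) * cubeAvg G h (K, j) ≤ ∫ x, h x := by
  simp only [← smul_eq_mul, volume_smul_cubeAvg]
  rw [← integral_biUnion_finset J (fun j _ => G.measurableSet_cube _)
    (fun j _ j' _ hj => G.disjoint_cube hj) (fun j _ => hi.integrableOn)]
  exact setIntegral_le_integral hi (.of_forall h0)

/-- A finite set of cubes is contained in finitely many finite trees with roots in one
generation. -/
lemma exists_roots (S : Finset (CubeIndex d)) :
    ∃ (K : ℤ) (n : ℕ) (J : Finset (Fin d → ℤ)),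
      S ⊆ J.biUnion fun j => descendants n (K, j) := by
  obtain ⟨a, ha⟩ := (S.image Prod.fst).bddAbove
  obtain ⟨b, hb⟩ := (S.image Prod.fst).bddBelow
  -- The roots are the ancestors in the generation a, an upper bound for the generations in S; from
  -- b up to a there are a - b + 1 generations.
  refine ⟨a, (a - b).toNat + 1,
    S.image fun Q => fun i => Q.2 i / 2 ^ (a - Q.1).toNat, fun Q hQ => ?_⟩
  have h1 : Q.1 ≤ a := ha (Finset.mem_coe.2 (Finset.mem_image_of_mem _ hQ))
  have h2 : b ≤ Q.1 := hb (Finset.mem_coe.2 (Finset.mem_image_of_mem _ hQ))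
  rw [Finset.mem_biUnion]
  refine ⟨_, Finset.mem_image_of_mem _ hQ, ?_⟩
  have := mem_descendants (a - Q.1).toNat ((a - b).toNat + 1) Q.1 Q.2 (by omega)
  rwa [Int.toNat_of_nonneg (by omega), add_sub_cancel] at this

variable {G}

/-- The bilinear square function estimate for a Haar shift. -/
theorem exists_sum_osc_mul_osc_le (hd : 1 ≤ d) {p q : ℝ} (hpq : p.HolderConjugate q)
    (σ : ShiftData G) :
    ∃ D : ℝ, 0 ≤ D ∧ ∀ f g : (Fin d → ℝ) → 𝕜, Integrable f → (Integrable fun x => ‖f x‖ ^ p) →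
      Integrable g → (Integrable fun x => ‖g x‖ ^ q) → ∀ S : Finset (CubeIndex d),
      ∑ Q ∈ S, volume.real (G.cube Q) * (cubeOsc G f Q * cubeOsc G g (σ.onCube Q)) ≤
        D * ((∫ x, ‖f x‖ ^ p) + ∫ x, ‖g x‖ ^ q) := by
  obtain ⟨D, hD, h⟩ := exists_mixedSum_le (Fin d → Fin 2) hpq
  refine ⟨2 ^ d * D, by positivity, fun f g hf hfp hg hgq S => ?_⟩
  obtain ⟨K, n, J, hS⟩ := exists_roots S
  set w : CubeIndex d → ℝ := fun Q =>
    volume.real (G.cube Q) * (cubeOsc G f Q * cubeOsc G g (σ.onCube Q)) with hw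
  have hα := cubeOsc_nonneg G f
  have hβ := cubeOsc_nonneg G g
  have hw0 : ∀ Q, 0 ≤ w Q := fun Q =>
    mul_nonneg measureReal_nonneg (mul_nonneg (hα _) (hβ _))
  have hw1 : ∀ Q, w Q ≤ volume.real (G.cube Q) * ∑ e,
      (cubeOsc G f Q * cubeOsc G g (child Q e) + cubeOsc G g Q * cubeOsc G f (child Q e)) := by
    intro Q
    -- All terms of the symmetric sum over children are nonnegative, so the one for the child σ(Q)
    -- may be singled out.
    obtain ⟨e, he⟩ := σ.exists_onCube_eq_child hd Q
    refine mul_le_mul_of_nonneg_left ?_ measureReal_nonneg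
    rw [he]
    refine le_trans (le_add_of_nonneg_right (mul_nonneg (hβ Q) (hα (child Q e))))
      (Finset.single_le_sum (f := fun e => cubeOsc G f Q * cubeOsc G g (child Q e) +
        cubeOsc G g Q * cubeOsc G f (child Q e)) (fun e _ => ?_) (Finset.mem_univ e))
    exact add_nonneg (mul_nonneg (hα _) (hβ _)) (mul_nonneg (hβ _) (hα _))
  calc ∑ Q ∈ S, w Q ≤ ∑ Q ∈ J.biUnion fun j => descendants n (K, j), w Q :=
        Finset.sum_le_sum_of_subset_of_nonneg hS fun Q _ _ => hw0 Q
    _ ≤ ∑ j ∈ J, ∑ Q ∈ descendants n (K, j), w Q := sum_biUnion_le_of_nonneg hw0 _ _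
    _ ≤ ∑ j ∈ J, 2 ^ d * (volume.real (G.cube (K, j)) *
          (D * (cubeAvg G (fun x => ‖f x‖ ^ p) (K, j) +
            cubeAvg G (fun x => ‖g x‖ ^ q) (K, j)))) := by
        refine Finset.sum_le_sum fun j _ => (sum_descendants_le G hw0 hw1 n (K, j)).trans ?_
        gcongr
        exact h (isAvgSystem G hpq.lt.le hf hfp) (isAvgSystem G hpq.symm.lt.le hg hgq) n (K, j)
    _ = 2 ^ d * D * (∑ j ∈ J, volume.real (G.cube (K, j)) *
          cubeAvg G (fun x => ‖f x‖ ^ p) (K, j) + ∑ j ∈ J, volume.real (G.cube (K, j)) *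
          cubeAvg G (fun x => ‖g x‖ ^ q) (K, j)) := by
        rw [← Finset.sum_add_distrib, Finset.mul_sum]
        exact Finset.sum_congr rfl fun j _ => by ring
    _ ≤ _ := by
        gcongr
        · exact sum_volume_mul_cubeAvg_le G (fun x => by positivity) hfp K J
        · exact sum_volume_mul_cubeAvg_le G (fun x => by positivity) hgq K J

/-! ### Haar expansions and the bilinear form of a Haar shift. -/

variable (G)

lemma coe_haarBasis (q : CubeIndex d × Sig d) :
    ((haarBasis 𝕜 G q : haarSpan 𝕜 G) : (Fin d → ℝ) → 𝕜) = haar 𝕜 G q :=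
  congrArg Subtype.val (Module.Basis.span_apply (haar_linearIndependent (𝕜 := 𝕜) G) q)

lemma integral_haar_mul_haar (q r : CubeIndex d × Sig d) :
    ∫ x, haar 𝕜 G q x * haar 𝕜 G r x = if q = r then 1 else 0 := by
  have h : ∀ x, haar 𝕜 G q x * haar 𝕜 G r x = ((haarReal G q x * haarReal G r x : ℝ) : 𝕜) :=
    fun x => by simp [haar]
  simp only [h, integral_ofReal]
  split_ifs with hqr
  · rw [hqr, haarReal_sq_integral, RCLike.ofReal_one]
  · rw [haarReal_integral_of_ne G q r hqr, RCLike.ofReal_zero]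

lemma haarBasis_sum_repr_apply (f : haarSpan 𝕜 G) (x : Fin d → ℝ) :
    (f : (Fin d → ℝ) → 𝕜) x =
      ∑ q ∈ ((haarBasis 𝕜 G).repr f).support, (haarBasis 𝕜 G).repr f q * haar 𝕜 G q x := by
  conv_lhs => rw [← (haarBasis 𝕜 G).linearCombination_repr f]
  rw [Finsupp.linearCombination_apply, Finsupp.sum]
  simp [coe_haarBasis]

/-- Orthonormality; no conjugate appears since Haar functions are real. -/
lemma integral_haar_mul_coe (f : haarSpan 𝕜 G) (q : CubeIndex d × Sig d) :
    ∫ x, haar 𝕜 G q x * (f : (Fin d → ℝ) → 𝕜) x = (haarBasis 𝕜 G).repr f q := by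
  classical
  have h : ∀ x, haar 𝕜 G q x * (f : (Fin d → ℝ) → 𝕜) x =
      ∑ r ∈ ((haarBasis 𝕜 G).repr f).support,
        (haarBasis 𝕜 G).repr f r * (haar 𝕜 G q x * haar 𝕜 G r x) := fun x => by
    rw [haarBasis_sum_repr_apply, Finset.mul_sum]
    exact Finset.sum_congr rfl fun r _ => mul_left_comm _ _ _
  simp only [h]
  rw [integral_finsetSum _ fun r _ =>
    (haar_mul_integrable G (haar_isBddFun G r).integrable q).const_mul _]
  simp only [integral_const_mul, integral_haar_mul_haar, mul_ite, mul_one, mul_zero,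
    Finset.sum_ite_eq, Finsupp.mem_support_iff, ne_eq, ite_not]
  split_ifs with h0
  · exact h0.symm
  · rfl

variable {G}

/-- The image of a Haar function under a Haar shift, as a function. -/
def shiftedHaar (𝕜 : Type*) [RCLike 𝕜] (σ : ShiftData G) (q : CubeIndex d × Sig d) :
    (Fin d → ℝ) → 𝕜 :=
  match σ.onSig q.2 with
  | none => 0
  | some ε => haar 𝕜 G (σ.onCube q.1, ε)

lemma shiftedHaar_of_none {σ : ShiftData G} {q : CubeIndex d × Sig d} (h : σ.onSig q.2 = none) :
    shiftedHaar 𝕜 σ q = 0 := by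
  simp only [shiftedHaar, h]

lemma shiftedHaar_of_some {σ : ShiftData G} {q : CubeIndex d × Sig d} {ε : Sig d}
    (h : σ.onSig q.2 = some ε) : shiftedHaar 𝕜 σ q = haar 𝕜 G (σ.onCube q.1, ε) := by
  simp only [shiftedHaar, h]

lemma haarShift_apply (σ : ShiftData G) (f : haarSpan 𝕜 G) (x : Fin d → ℝ) :
    (haarShift 𝕜 σ f : (Fin d → ℝ) → 𝕜) x =
      ∑ q ∈ ((haarBasis 𝕜 G).repr f).support,
        (haarBasis 𝕜 G).repr f q * shiftedHaar 𝕜 σ q x := by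
  rw [haarShift, Module.Basis.constr_apply, Finsupp.sum, Submodule.coe_sum, Finset.sum_apply]
  refine Finset.sum_congr rfl fun q _ => ?_
  rw [Submodule.coe_smul, Pi.smul_apply, smul_eq_mul]
  congr 1
  rcases h : σ.onSig q.2 with _ | ε
  · rw [shiftedHaar_of_none h]; rfl
  · rw [shiftedHaar_of_some h, coe_haarBasis]

lemma integrable_shiftedHaar_mul (σ : ShiftData G) {g : (Fin d → ℝ) → 𝕜} (hg : Integrable g)
    (q : CubeIndex d × Sig d) : Integrable fun x => shiftedHaar 𝕜 σ q x * g x := by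
  rcases h : σ.onSig q.2 with _ | ε
  · simp [shiftedHaar_of_none h]
  · rw [shiftedHaar_of_some h]
    exact haar_mul_integrable G hg _

lemma norm_coeff_mul_integral_shiftedHaar_le (hd : 1 ≤ d) (σ : ShiftData G)
    (f : haarSpan 𝕜 G) {g : (Fin d → ℝ) → 𝕜} (hg : Integrable g) (q : CubeIndex d × Sig d) :
    ‖(haarBasis 𝕜 G).repr f q * ∫ x, shiftedHaar 𝕜 σ q x * g x‖ ≤
      volume.real (G.cube q.1) *
        (cubeOsc G (f : (Fin d → ℝ) → 𝕜) q.1 * cubeOsc G g (σ.onCube q.1)) := by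
  have hV := G.volume_real_pos q.1
  have hs := G.side_pos q.1
  have hα := cubeOsc_nonneg G (f : (Fin d → ℝ) → 𝕜) q.1
  have hβ := cubeOsc_nonneg G g (σ.onCube q.1)
  rw [norm_mul]
  rcases h : σ.onSig q.2 with _ | ε
  · simp only [shiftedHaar_of_none h, Pi.zero_apply, zero_mul, integral_zero, norm_zero, mul_zero]
    positivity
  · rw [shiftedHaar_of_some h]
    have h1 := norm_integral_haar_mul_le G (haarSpan_isBddFun f).integrable q
    rw [integral_haar_mul_coe] at h1
    have h2 := norm_integral_haar_mul_le G hg (σ.onCube q.1, ε)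
    refine (mul_le_mul h1 h2 (norm_nonneg _) (by positivity)).trans ?_
    obtain ⟨e, he⟩ := σ.exists_onCube_eq_child hd q.1
    have hs2 : G.side (σ.onCube q.1) = G.side q.1 / 2 := by rw [he, G.side_child]
    have hV2 : volume.real (G.cube (σ.onCube q.1)) = G.side q.1 ^ d / 2 ^ d := by
      rw [he, G.volume_real_child, G.volume_real_cube]
    dsimp only
    rw [hs2, hV2, G.volume_real_cube]
    -- The normalizations |Q|^(-1/2) and |σ(Q)|^(-1/2) cancel against |σ(Q)|, since |σ(Q)| ≤ |Q|;
    -- the factor |Q| is left over as the weight.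
    have key : (G.side q.1 ^ (-(1 / 2) : ℝ)) ^ d * ((G.side q.1 / 2) ^ (-(1 / 2) : ℝ)) ^ d *
        (G.side q.1 ^ d / 2 ^ d) ≤ 1 := by
      rw [← mul_pow, ← div_pow, ← mul_pow]
      refine pow_le_one₀ (by positivity) ?_
      calc G.side q.1 ^ (-(1 / 2) : ℝ) * (G.side q.1 / 2) ^ (-(1 / 2) : ℝ) * (G.side q.1 / 2)
          ≤ (G.side q.1 / 2) ^ (-(1 / 2) : ℝ) * (G.side q.1 / 2) ^ (-(1 / 2) : ℝ) *
            (G.side q.1 / 2) := by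
            gcongr ?_ * _ * _
            exact Real.rpow_le_rpow_of_nonpos (by positivity) (by linarith) (by norm_num)
        _ = 1 := by
            rw [← Real.rpow_add (by positivity), ← Real.rpow_add_one (by positivity)]
            norm_num
    calc _ = (G.side q.1 ^ (-(1 / 2) : ℝ)) ^ d * ((G.side q.1 / 2) ^ (-(1 / 2) : ℝ)) ^ d *
        (G.side q.1 ^ d / 2 ^ d) *
          (G.side q.1 ^ d *
            (cubeOsc G (f : (Fin d → ℝ) → 𝕜) q.1 * cubeOsc G g (σ.onCube q.1))) := by ring
      _ ≤ 1 * (G.side q.1 ^ d *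
          (cubeOsc G (f : (Fin d → ℝ) → 𝕜) q.1 * cubeOsc G g (σ.onCube q.1))) := by
        gcongr
      _ = _ := one_mul _

lemma IsBddFun.norm_rpow {f : (Fin d → ℝ) → 𝕜} (hf : IsBddFun f) {p : ℝ} (hp : 0 < p) :
    IsBddFun fun x => ‖f x‖ ^ p := by
  obtain ⟨mf, ⟨C, hC⟩, bf⟩ := hf
  refine ⟨by fun_prop, ⟨C ^ p, fun x => ?_⟩, bf.subset fun x hx => ?_⟩
  · rw [Real.norm_of_nonneg (by positivity)]
    exact Real.rpow_le_rpow (norm_nonneg _) (hC x) hp.le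
  · contrapose! hx
    simp only [Function.mem_support, not_not] at hx ⊢
    rw [hx, norm_zero, Real.zero_rpow hp.ne']

/-- The triangle inequality over the Haar expansion reduces this to the oscillation sum. The bound
of each term depends on its cube alone, whence the factor counting signatures. -/
theorem exists_norm_integral_haarShift_mul_le (hd : 1 ≤ d) {p q : ℝ} (hpq : p.HolderConjugate q)
    (σ : ShiftData G) :
    ∃ D : ℝ, 0 ≤ D ∧ ∀ (f : haarSpan 𝕜 G) (g : (Fin d → ℝ) → 𝕜), IsBddFun g →
      ‖∫ x, (haarShift 𝕜 σ f : (Fin d → ℝ) → 𝕜) x * g x‖ ≤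
        D * ((∫ x, ‖(f : (Fin d → ℝ) → 𝕜) x‖ ^ p) + ∫ x, ‖g x‖ ^ q) := by
  classical
  obtain ⟨D, hD, h⟩ := exists_sum_osc_mul_osc_le (𝕜 := 𝕜) hd hpq σ
  refine ⟨Fintype.card (Sig d) * D, by positivity, fun f g hg => ?_⟩
  have hf := haarSpan_isBddFun f
  set F := ((haarBasis 𝕜 G).repr f).support with hF
  set w : CubeIndex d → ℝ := fun Q =>
    volume.real (G.cube Q) *
      (cubeOsc G (f : (Fin d → ℝ) → 𝕜) Q * cubeOsc G g (σ.onCube Q)) with hw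
  have hw0 : ∀ Q, 0 ≤ w Q := fun Q =>
    mul_nonneg measureReal_nonneg (mul_nonneg (cubeOsc_nonneg _ _ _) (cubeOsc_nonneg _ _ _))
  have e1 : ∫ x, (haarShift 𝕜 σ f : (Fin d → ℝ) → 𝕜) x * g x =
      ∑ q ∈ F, (haarBasis 𝕜 G).repr f q * ∫ x, shiftedHaar 𝕜 σ q x * g x := by
    simp only [haarShift_apply, Finset.sum_mul, mul_assoc]
    rw [integral_finsetSum _ fun q _ =>
      (integrable_shiftedHaar_mul σ hg.integrable q).const_mul _]
    simp only [integral_const_mul, hF]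
  rw [e1]
  calc _ ≤ ∑ q ∈ F, w q.1 := (norm_sum_le _ _).trans (Finset.sum_le_sum fun q _ =>
        norm_coeff_mul_integral_shiftedHaar_le hd σ f hg.integrable q)
    _ ≤ ∑ q ∈ F.image Prod.fst ×ˢ (Finset.univ : Finset (Sig d)), w q.1 :=
        Finset.sum_le_sum_of_subset_of_nonneg (fun q hq => Finset.mem_product.2
          ⟨Finset.mem_image_of_mem _ hq, Finset.mem_univ _⟩) fun q _ _ => hw0 _
    _ = Fintype.card (Sig d) * ∑ Q ∈ F.image Prod.fst, w Q := by
        rw [Finset.sum_product, Finset.mul_sum]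
        simp
    _ ≤ Fintype.card (Sig d) * (D * ((∫ x, ‖(f : (Fin d → ℝ) → 𝕜) x‖ ^ p) + ∫ x, ‖g x‖ ^ q)) := by
        gcongr
        exact h f g hf.integrable (hf.norm_rpow hpq.pos).integrable hg.integrable
          (hg.norm_rpow hpq.symm.pos).integrable _
    _ = _ := by ring

/-- The dual function `conj f |f|^{p-2}` of a function `f`. -/
def dualFun (p : ℝ) (f : (Fin d → ℝ) → 𝕜) (x : Fin d → ℝ) : 𝕜 :=
  (starRingEnd 𝕜) (f x) * ((‖f x‖ ^ (p - 2) : ℝ) : 𝕜)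

lemma norm_dualFun {p : ℝ} (hp : 1 < p) (f : (Fin d → ℝ) → 𝕜) (x : Fin d → ℝ) :
    ‖dualFun p f x‖ = ‖f x‖ ^ (p - 1) := by
  rw [dualFun, norm_mul, RCLike.norm_conj, RCLike.norm_ofReal,
    abs_of_nonneg (Real.rpow_nonneg (norm_nonneg _) _)]
  rcases eq_or_ne (f x) 0 with h | h
  · rw [h, norm_zero, zero_mul, Real.zero_rpow (by linarith)]
  · rw [mul_comm, ← Real.rpow_add_one (norm_ne_zero_iff.2 h)]
    congr 1; ring

lemma mul_dualFun {p : ℝ} (hp : 1 < p) (f : (Fin d → ℝ) → 𝕜) (x : Fin d → ℝ) :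
    f x * dualFun p f x = ((‖f x‖ ^ p : ℝ) : 𝕜) := by
  rw [dualFun, ← mul_assoc, RCLike.mul_conj, ← RCLike.ofReal_pow, ← RCLike.ofReal_mul]
  congr 1
  rcases eq_or_ne (f x) 0 with h | h
  · rw [h, norm_zero, zero_pow two_ne_zero, zero_mul, Real.zero_rpow (by linarith)]
  · rw [← Real.rpow_natCast, ← Real.rpow_add (norm_pos_iff.2 h)]
    congr 1; push_cast; ring

lemma IsBddFun.dualFun {p : ℝ} (hp : 1 < p) {f : (Fin d → ℝ) → 𝕜} (hf : IsBddFun f) :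
    IsBddFun (dualFun p f) := by
  have hn := hf.norm_rpow (p := p - 1) (by linarith)
  obtain ⟨mf, -, bf⟩ := hf
  obtain ⟨-, ⟨C, hC⟩, -⟩ := hn
  refine ⟨?_, ⟨C, fun x => ?_⟩, bf.subset fun x hx => ?_⟩
  · unfold DyadicHaar.dualFun
    exact (RCLike.continuous_conj.measurable.comp mf).mul
      (RCLike.measurable_ofReal.comp (mf.norm.pow_const _))
  · rw [norm_dualFun hp]
    exact (le_abs_self _).trans (hC x)
  · contrapose! hx
    simp only [Function.mem_support, not_not] at hx ⊢
    simp [DyadicHaar.dualFun, hx]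

/-- One-parameter Haar shifts are bounded on `L^p` for `1 < p < ∞`. -/
theorem exists_integral_haarShift_rpow_le (hd : 1 ≤ d) {p : ℝ} (hp : 1 < p) (σ : ShiftData G) :
    ∃ D : ℝ, 0 ≤ D ∧ ∀ f : haarSpan 𝕜 G,
      ∫ x, ‖(haarShift 𝕜 σ f : (Fin d → ℝ) → 𝕜) x‖ ^ p ≤
        D * ∫ x, ‖(f : (Fin d → ℝ) → 𝕜) x‖ ^ p := by
  have hpq := Real.HolderConjugate.conjExponent hp
  set q := p.conjExponent
  obtain ⟨D, hD, h⟩ := exists_norm_integral_haarShift_mul_le (𝕜 := 𝕜) hd hpq σ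
  refine ⟨D * (D + 1) ^ p, by positivity, fun f => ?_⟩
  have hb := haarSpan_isBddFun (haarShift 𝕜 σ f)
  set X := ∫ x, ‖(haarShift 𝕜 σ f : (Fin d → ℝ) → 𝕜) x‖ ^ p with hX
  -- Scaling f by D + 1 gives (D + 1) X ≤ D ((D + 1)^p ∫|f|^p + X), so the X on the right is
  -- absorbed with coefficient one to spare.
  have h1 := h (((D + 1 : ℝ) : 𝕜) • f) (dualFun p (haarShift 𝕜 σ f)) (hb.dualFun hp)
  have e1 : ∀ x, ((((D + 1 : ℝ) : 𝕜) • f : haarSpan 𝕜 G) : (Fin d → ℝ) → 𝕜) x =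
      ((D + 1 : ℝ) : 𝕜) * (f : (Fin d → ℝ) → 𝕜) x := fun x => rfl
  have e2 : ∀ x, (haarShift 𝕜 σ (((D + 1 : ℝ) : 𝕜) • f) : (Fin d → ℝ) → 𝕜) x =
      ((D + 1 : ℝ) : 𝕜) * (haarShift 𝕜 σ f : (Fin d → ℝ) → 𝕜) x := fun x => by
    rw [map_smul]; rfl
  have e3 : ∀ x, ‖((D + 1 : ℝ) : 𝕜) * (f : (Fin d → ℝ) → 𝕜) x‖ ^ p =
      (D + 1) ^ p * ‖(f : (Fin d → ℝ) → 𝕜) x‖ ^ p := fun x => by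
    rw [norm_mul, RCLike.norm_ofReal, abs_of_nonneg (by positivity),
      Real.mul_rpow (by positivity) (norm_nonneg _)]
  have e4 : ∀ x, ‖dualFun p (haarShift 𝕜 σ f : (Fin d → ℝ) → 𝕜) x‖ ^ q =
      ‖(haarShift 𝕜 σ f : (Fin d → ℝ) → 𝕜) x‖ ^ p := fun x => by
    rw [norm_dualFun hp, ← Real.rpow_mul (norm_nonneg _), hpq.sub_one_mul_conj]
  simp only [e1, e3] at h1
  simp only [e2, mul_assoc, mul_dualFun hp, integral_const_mul, e4, integral_ofReal,
    norm_mul, RCLike.norm_ofReal] at h1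
  rw [← hX, abs_of_nonneg (by positivity),
    abs_of_nonneg (integral_nonneg fun x => by positivity)] at h1
  linarith

theorem exists_lintegral_haarShift_rpow_le (𝕜 : Type*) [RCLike 𝕜] (hd : 1 ≤ d) {p : ℝ}
    (hp : 1 < p) (σ : ShiftData G) :
    ∃ D : ℝ≥0∞, D ≠ ∞ ∧ ∀ f : haarSpan 𝕜 G,
      ∫⁻ x, ‖(haarShift 𝕜 σ f : (Fin d → ℝ) → 𝕜) x‖ₑ ^ p ≤
        D * ∫⁻ x, ‖(f : (Fin d → ℝ) → 𝕜) x‖ₑ ^ p := by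
  obtain ⟨D, hD, h⟩ := exists_integral_haarShift_rpow_le (𝕜 := 𝕜) hd hp σ
  have hp0 : 0 < p := by linarith
  have key : ∀ f : haarSpan 𝕜 G, ∫⁻ x, ‖(f : (Fin d → ℝ) → 𝕜) x‖ₑ ^ p =
      ENNReal.ofReal (∫ x, ‖(f : (Fin d → ℝ) → 𝕜) x‖ ^ p) := fun f => by
    rw [ofReal_integral_eq_lintegral_ofReal ((haarSpan_isBddFun f).norm_rpow hp0).integrable
      (.of_forall fun x => by positivity)]
    refine lintegral_congr fun x => ?_
    rw [← ENNReal.ofReal_rpow_of_nonneg (norm_nonneg _) hp0.le, ofReal_norm]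
  refine ⟨ENNReal.ofReal D, ENNReal.ofReal_ne_top, fun f => ?_⟩
  rw [key, key, ← ENNReal.ofReal_mul hD]
  exact ENNReal.ofReal_le_ofReal (h f)

end OneParameter

/-! ### Tensor products of Haar shifts on `L^p` -/

section TensorBound

variable {t : ℕ} {d : Fin t → ℕ} {𝕜 : Type*} [RCLike 𝕜] {G : ∀ s, DyadicGrid (d s)}

/-- Slices of tensors in one variable belong to the span of the Haar functions, and an operator
that acts in this variable acts on the slices. -/
lemma exists_slice (s : Fin t) (A : haarSpan 𝕜 (G s) →ₗ[𝕜] haarSpan 𝕜 (G s))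
    (u : HaarTensor 𝕜 G) :
    ∃ φ : ProdSpace d → haarSpan 𝕜 (G s), ∀ x y,
      tensorFun 𝕜 G u (Function.update x s y) = (φ x : (Fin (d s) → ℝ) → 𝕜) y ∧
      tensorFun 𝕜 G (PiTensorProduct.map (Function.update (fun _ => LinearMap.id) s A) u)
        (Function.update x s y) = (A (φ x) : (Fin (d s) → ℝ) → 𝕜) y := by
  induction u using PiTensorProduct.induction_on with
  | smul_tprod r f =>
    -- With the other variables frozen, a pure tensor is a scalar multiple of its factor in the
    -- variable s.
    refine ⟨fun x => (r * ∏ i ∈ Finset.univ.erase s, (f i : (Fin (d i) → ℝ) → 𝕜) (x i)) • f s,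
      fun x y => ⟨?_, ?_⟩⟩
    · rw [map_smul, Pi.smul_apply, tensorFun_tprod, Submodule.coe_smul, Pi.smul_apply,
        ← Finset.mul_prod_erase _ _ (Finset.mem_univ s), Function.update_self, smul_eq_mul,
        smul_eq_mul]
      rw [Finset.prod_congr rfl fun i hi => by
        rw [Function.update_of_ne (Finset.ne_of_mem_erase hi)]]
      ring
    · rw [map_smul, map_smul, Pi.smul_apply, PiTensorProduct.map_tprod, tensorFun_tprod, map_smul,
        Submodule.coe_smul, Pi.smul_apply, ← Finset.mul_prod_erase _ _ (Finset.mem_univ s),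
        Function.update_self, Function.update_self, smul_eq_mul, smul_eq_mul]
      rw [Finset.prod_congr rfl fun i hi => by
        rw [Function.update_of_ne (Finset.ne_of_mem_erase hi),
          Function.update_of_ne (Finset.ne_of_mem_erase hi), LinearMap.id_apply]]
      ring
  | add u v hu hv =>
    obtain ⟨φ, hφ⟩ := hu
    obtain ⟨ψ, hψ⟩ := hv
    refine ⟨fun x => φ x + ψ x, fun x y => ⟨?_, ?_⟩⟩
    · rw [map_add, Pi.add_apply, (hφ x y).1, (hψ x y).1]; rfl
    · rw [map_add, map_add, Pi.add_apply, (hφ x y).2, (hψ x y).2, map_add]; rfl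

/-- Tonelli: the variable s is integrated first, the remaining ones by monotonicity. -/
lemma lintegral_le_of_update_le (s : Fin t) {F₁ F₂ : ProdSpace d → ℝ≥0∞} (h₁ : Measurable F₁)
    (h₂ : Measurable F₂)
    (h : ∀ x, ∫⁻ y, F₁ (Function.update x s y) ≤ ∫⁻ y, F₂ (Function.update x s y)) :
    ∫⁻ x, F₁ x ≤ ∫⁻ x, F₂ x := by
  rw [volume_pi, lintegral_eq_lmarginal_univ (0 : ProdSpace d),
    lintegral_eq_lmarginal_univ (0 : ProdSpace d),
    lmarginal_erase' F₁ h₁ (Finset.mem_univ s), lmarginal_erase' F₂ h₂ (Finset.mem_univ s)]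
  exact lmarginal_mono (fun x => h x) _

lemma measurable_tensorFun_rpow (u : HaarTensor 𝕜 G) (p : ℝ) :
    Measurable fun x => ‖tensorFun 𝕜 G u x‖ₑ ^ p :=
  (tensorFun_isBddFun u).1.enorm.pow_const p

lemma lintegral_map_update_le {p : ℝ} {D : ℝ≥0∞} (s : Fin t)
    (A : haarSpan 𝕜 (G s) →ₗ[𝕜] haarSpan 𝕜 (G s)) (hA : ∀ f : haarSpan 𝕜 (G s),
      ∫⁻ y, ‖(A f : (Fin (d s) → ℝ) → 𝕜) y‖ₑ ^ p ≤
        D * ∫⁻ y, ‖(f : (Fin (d s) → ℝ) → 𝕜) y‖ₑ ^ p) (u : HaarTensor 𝕜 G) :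
    ∫⁻ x, ‖tensorFun 𝕜 G (PiTensorProduct.map
      (Function.update (fun _ => LinearMap.id) s A) u) x‖ₑ ^ p ≤
      D * ∫⁻ x, ‖tensorFun 𝕜 G u x‖ₑ ^ p := by
  obtain ⟨φ, hφ⟩ := exists_slice s A u
  rw [← lintegral_const_mul _ (measurable_tensorFun_rpow u p)]
  refine lintegral_le_of_update_le s (measurable_tensorFun_rpow _ p)
    ((measurable_tensorFun_rpow u p).const_mul D) fun x => ?_
  simp only [(hφ x _).1, (hφ x _).2]
  rw [lintegral_const_mul _ ((haarSpan_isBddFun (φ x)).1.enorm.pow_const p)]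
  exact hA (φ x)

/-- The tensor product of the shifts is a composition of operators acting in a single variable.
Induction over the set of variables already treated multiplies their constants. -/
theorem exists_lintegral_tensorShift_le (𝕜 : Type*) [RCLike 𝕜] (hd : ∀ s, 1 ≤ d s) {p : ℝ}
    (hp : 1 < p) (σ : ∀ s, ShiftData (G s)) :
    ∃ D : ℝ≥0∞, D ≠ ∞ ∧ ∀ u : HaarTensor 𝕜 G,
      ∫⁻ x, ‖tensorFun 𝕜 G (tensorShift 𝕜 σ u) x‖ₑ ^ p ≤
        D * ∫⁻ x, ‖tensorFun 𝕜 G u x‖ₑ ^ p := by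
  suffices h : ∀ S : Finset (Fin t), ∃ D : ℝ≥0∞, D ≠ ∞ ∧ ∀ u : HaarTensor 𝕜 G,
      ∫⁻ x, ‖tensorFun 𝕜 G (PiTensorProduct.map (S.piecewise (fun s => haarShift 𝕜 (σ s))
        fun _ => LinearMap.id) u) x‖ₑ ^ p ≤ D * ∫⁻ x, ‖tensorFun 𝕜 G u x‖ₑ ^ p by
    simpa only [Finset.piecewise_univ, tensorShift] using h Finset.univ
  intro S
  induction S using Finset.induction_on with
  | empty =>
    refine ⟨1, ENNReal.one_ne_top, fun u => ?_⟩
    rw [Finset.piecewise_empty, PiTensorProduct.map_id, LinearMap.id_apply, one_mul]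
  | insert s S hs ih =>
    obtain ⟨D, hD, h⟩ := ih
    obtain ⟨D', hD', h'⟩ := exists_lintegral_haarShift_rpow_le 𝕜 (hd s) hp (σ s)
    refine ⟨D' * D, ENNReal.mul_ne_top hD' hD, fun u => ?_⟩
    have e : (insert s S).piecewise (fun s => haarShift 𝕜 (σ s)) (fun _ => LinearMap.id) =
        fun i => (Function.update (fun _ => LinearMap.id) s (haarShift 𝕜 (σ s)) :
          ∀ i, haarSpan 𝕜 (G i) →ₗ[𝕜] haarSpan 𝕜 (G i)) i ∘ₗ
          (S.piecewise (fun s => haarShift 𝕜 (σ s)) (fun _ => LinearMap.id)) i := by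
      funext i
      rcases eq_or_ne i s with rfl | hi
      · rw [Finset.piecewise_insert_self, Function.update_self,
          Finset.piecewise_eq_of_notMem _ _ _ hs, LinearMap.comp_id]
      · rw [Finset.piecewise_insert_of_ne S _ _ hi, Function.update_of_ne hi, LinearMap.id_comp]
    rw [e, PiTensorProduct.map_comp, LinearMap.comp_apply, mul_assoc]
    refine (lintegral_map_update_le s _ h' _).trans ?_
    gcongr
    exact h u

theorem exists_norm_tensorShift_le (𝕜 : Type*) [RCLike 𝕜] (hd : ∀ s, 1 ≤ d s) {p : ℝ≥0∞}
    [Fact (1 ≤ p)] (hp : 1 < p) (hp' : p < ∞) (σ : ∀ s, ShiftData (G s)) :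
    ∃ C : ℝ, ∀ u : HaarTensor 𝕜 G,
      ‖tensorToLp 𝕜 G p (tensorShift 𝕜 σ u)‖ ≤ C * ‖tensorToLp 𝕜 G p u‖ := by
  have hp0 : p ≠ 0 := (zero_lt_one.trans hp).ne'
  have hpr : 1 < p.toReal := by
    rw [← ENNReal.toReal_one]
    exact (ENNReal.toReal_lt_toReal ENNReal.one_ne_top hp'.ne).2 hp
  obtain ⟨D, hD, h⟩ := exists_lintegral_tensorShift_le 𝕜 hd hpr σ
  refine ⟨(D ^ (1 / p.toReal)).toReal, fun u => ?_⟩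
  have hDp : D ^ (1 / p.toReal) ≠ ∞ := ENNReal.rpow_ne_top_of_nonneg (by positivity) hD
  simp only [tensorToLp, LinearMap.coe_mk, AddHom.coe_mk, Lp.norm_toLp]
  rw [← ENNReal.toReal_mul]
  refine ENNReal.toReal_mono
    (ENNReal.mul_ne_top hDp ((tensorFun_isBddFun u).memLp p).eLpNorm_ne_top) ?_
  rw [eLpNorm_eq_lintegral_rpow_enorm_toReal hp0 hp'.ne,
    eLpNorm_eq_lintegral_rpow_enorm_toReal hp0 hp'.ne,
    ← ENNReal.mul_rpow_of_nonneg _ _ (by positivity)]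
  exact ENNReal.rpow_le_rpow (h u) (by positivity)

end TensorBound

/-! ### Indicators of cubes and Haar functions -/

section Telescoping

variable {d : ℕ} (G : DyadicGrid d) (𝕜 : Type*) [RCLike 𝕜]

/-- The indicator function of a cube. -/
def cubeFun (Q : CubeIndex d) : (Fin d → ℝ) → 𝕜 := (G.cube Q).indicator 1

/-- The label of the dyadic parent of a cube. -/
def parent (Q : CubeIndex d) : CubeIndex d := (Q.1 + 1, fun i => Q.2 i / 2)

lemma exists_child_parent (Q : CubeIndex d) : ∃ e, child (parent Q) e = Q := by
  refine ⟨fun i => if Q.2 i % 2 = 0 then 0 else 1, Prod.ext (by simp [child, parent])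
    (funext fun i => ?_)⟩
  simp only [child, parent]
  split_ifs with h
  · simp only [Fin.val_zero]; omega
  · simp only [Fin.val_one]; omega

/-- On an interval, the indicator of one half is a combination of the two Haar functions. -/
lemma half_indicator_eq (l : ℝ) {ℓ x : ℝ} (hℓ : 0 < ℓ) (hx : x ∈ Set.Ioo l (l + ℓ)) (e : Fin 2) :
    (Set.Ico (l + (e : ℕ) * (ℓ / 2)) (l + (e : ℕ) * (ℓ / 2) + ℓ / 2)).indicator (1 : ℝ → ℝ) x =
      ∑ a : Fin 2, (ℓ ^ (1 / 2 : ℝ) / 2 * if a = 1 then 1 else if e = 0 then -1 else 1) *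
        haarInterval a (l + ℓ / 2) ℓ x := by
  have h1 : ℓ ^ (1 / 2 : ℝ) * ℓ ^ (-(1 / 2) : ℝ) = 1 := by
    rw [← Real.rpow_add hℓ]; norm_num
  rw [Fin.sum_univ_two, haarInterval_one_eq l hℓ hx]
  have h2 : haarInterval 0 (l + ℓ / 2) ℓ x =
      ℓ ^ (-(1 / 2) : ℝ) * if x < l + ℓ / 2 then -1 else 1 := by
    rw [haarInterval, haarMother, if_pos rfl]
    congr 1
    split_ifs with hc
    · have k1 : (x - (l + ℓ / 2)) / ℓ < 0 := div_neg_of_neg_of_pos (by linarith) hℓ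
      have k2 : -(1 / 2) ≤ (x - (l + ℓ / 2)) / ℓ := by rw [le_div_iff₀ hℓ]; linarith [hx.1]
      simp only [Set.indicator_apply, Set.mem_Ico, Pi.one_apply]
      grind
    · have k1 : 0 ≤ (x - (l + ℓ / 2)) / ℓ := div_nonneg (by linarith) hℓ.le
      have k2 : (x - (l + ℓ / 2)) / ℓ < 1 / 2 := by rw [div_lt_iff₀ hℓ]; linarith [hx.2]
      simp only [Set.indicator_apply, Set.mem_Ico, Pi.one_apply]
      grind
  rw [h2]
  obtain ⟨hx1, hx2⟩ := hx
  rcases (by omega : e = 0 ∨ e = 1) with rfl | rfl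
  · by_cases hc : x < l + ℓ / 2
    · rw [Set.indicator_of_mem (by simp; constructor <;> linarith)]
      simp [hc]; linarith
    · rw [Set.indicator_of_notMem (by simp; intro; linarith)]
      simp [hc]
  · by_cases hc : x < l + ℓ / 2
    · rw [Set.indicator_of_notMem (by simp; intro; linarith)]
      simp [hc]
    · rw [Set.indicator_of_mem (by simp; constructor <;> linarith)]
      simp [hc]; linarith

/-- Inside Q the indicator of a child is a product over coordinates of half-interval indicators,
each a combination of h⁰ and h¹. Expanding the product gives one term per element of {0,1}^d; the
all-ones term is 2^(-d) times the indicator of Q, and the others are Haar functions. -/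
lemma exists_haarSpan_child_sub (Q : CubeIndex d) (e : Fin d → Fin 2) :
    ∃ v : haarSpan 𝕜 G, (v : (Fin d → ℝ) → 𝕜) =ᵐ[volume]
      fun x => cubeFun G 𝕜 (child Q e) x - ((2 : 𝕜) ^ d)⁻¹ * cubeFun G 𝕜 Q x := by
  set ℓ := G.side Q with hℓ
  have hs : 0 < ℓ := G.side_pos Q
  set c : Fin d → Fin 2 → ℝ := fun i a =>
    ℓ ^ (1 / 2 : ℝ) / 2 * if a = 1 then 1 else if e i = 0 then -1 else 1 with hc
  refine ⟨∑ ε : Sig d, ((∏ i, c i (ε.1 i) : ℝ) : 𝕜) • haarBasis 𝕜 G (Q, ε), ?_⟩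
  have hcoe : ∀ x, ((∑ ε : Sig d, ((∏ i, c i (ε.1 i) : ℝ) : 𝕜) • haarBasis 𝕜 G (Q, ε) :
      haarSpan 𝕜 G) : (Fin d → ℝ) → 𝕜) x =
      ((∑ ε : Sig d, (∏ i, c i (ε.1 i)) * haarReal G (Q, ε) x : ℝ) : 𝕜) := fun x => by
    simp [coe_haarBasis, haar]
  filter_upwards [(G.openCube_ae_eq Q).mem_iff] with x hx
  rw [hcoe]
  by_cases hxQ : x ∈ G.cube Q
  · have hxo : ∀ i, x i ∈ Set.Ioo (G.left Q i) (G.left Q i + ℓ) := fun i => hx.2 hxQ i trivial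
    have h1 : (G.cube (child Q e)).indicator (1 : (Fin d → ℝ) → ℝ) x = ∏ i,
        (Set.Ico (G.left Q i + (e i : ℕ) * (ℓ / 2))
          (G.left Q i + (e i : ℕ) * (ℓ / 2) + ℓ / 2)).indicator (1 : ℝ → ℝ) (x i) := by
      have hm : x ∈ G.cube (child Q e) ↔ ∀ i, x i ∈ Set.Ico (G.left Q i + (e i : ℕ) * (ℓ / 2))
          (G.left Q i + (e i : ℕ) * (ℓ / 2) + ℓ / 2) := by
        rw [G.mem_cube]
        simp only [G.left_child, G.side_child, Set.mem_Ico, hℓ]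
      by_cases h : x ∈ G.cube (child Q e)
      · rw [Set.indicator_of_mem h, Pi.one_apply, Finset.prod_eq_one]
        intro i _
        rw [Set.indicator_of_mem (hm.1 h i), Pi.one_apply]
      · rw [Set.indicator_of_notMem h]
        rw [hm] at h
        push Not at h
        obtain ⟨i, hi⟩ := h
        rw [Finset.prod_eq_zero (Finset.mem_univ i)]
        exact Set.indicator_of_notMem hi _
    have h2 : (G.cube (child Q e)).indicator (1 : (Fin d → ℝ) → ℝ) x =
        ∑ ε : Fin d → Fin 2, (∏ i, c i (ε i)) *
          ∏ i, haarInterval (ε i) (G.left Q i + ℓ / 2) ℓ (x i) := by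
      rw [h1, Finset.prod_congr rfl fun i _ => half_indicator_eq _ hs (hxo i) (e i),
        Finset.prod_univ_sum]
      simp only [Fintype.piFinset_univ, Finset.prod_mul_distrib, hc]
    have h3 : ∏ i, c i 1 * haarInterval 1 (G.left Q i + ℓ / 2) ℓ (x i) = ((2 : ℝ) ^ d)⁻¹ := by
      have h4 : ℓ ^ (1 / 2 : ℝ) * ℓ ^ (-(1 / 2) : ℝ) = 1 := by
        rw [← Real.rpow_add hs]; norm_num
      rw [Finset.prod_congr rfl fun i _ => by
        rw [haarInterval_one_eq _ hs (hxo i), show c i 1 = ℓ ^ (1 / 2 : ℝ) / 2 by simp [hc],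
          div_mul_eq_mul_div, h4]]
      simp
    rw [Fintype.sum_eq_add_sum_subtype_ne _ (fun _ => (1 : Fin 2)), ← Finset.prod_mul_distrib,
      h3] at h2
    have h5 : cubeFun G 𝕜 (child Q e) x =
        (((G.cube (child Q e)).indicator (1 : (Fin d → ℝ) → ℝ) x : ℝ) : 𝕜) := by
      by_cases h : x ∈ G.cube (child Q e) <;> simp [cubeFun, h]
    have h6 : cubeFun G 𝕜 Q x = 1 := by rw [cubeFun, Set.indicator_of_mem hxQ, Pi.one_apply]
    rw [h5, h6, h2]
    push_cast
    simp only [haarReal, hℓ]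
    push_cast
    ring
  · have h1 : x ∉ G.cube (child Q e) := fun h => hxQ (G.cube_child_subset Q e h)
    simp [cubeFun, hxQ, h1, fun ε => haarReal_eq_zero G (Q, ε) x hxQ]

/-- Up to a Haar sum, the indicator of a cube is spread over any of its ancestors. -/
lemma exists_haarSpan_ancestor_sub (Q : CubeIndex d) (n : ℕ) :
    ∃ v : haarSpan 𝕜 G, (v : (Fin d → ℝ) → 𝕜) =ᵐ[volume]
      fun x => cubeFun G 𝕜 Q x - ((2 : 𝕜) ^ (d * n))⁻¹ * cubeFun G 𝕜 (parent^[n] Q) x := by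
  induction n with
  | zero => exact ⟨0, .of_forall fun x => by simp⟩
  | succ n ih =>
    obtain ⟨v, hv⟩ := ih
    obtain ⟨e, he⟩ := exists_child_parent (parent^[n] Q)
    obtain ⟨w, hw⟩ := exists_haarSpan_child_sub G 𝕜 (parent (parent^[n] Q)) e
    -- Telescoping: w replaces the indicator of the n-th ancestor by 2^(-d) times that of its
    -- parent.
    refine ⟨v + ((2 : 𝕜) ^ (d * n))⁻¹ • w, ?_⟩
    filter_upwards [hv, hw] with x h1 h2
    rw [he] at h2
    rw [Submodule.coe_add, Submodule.coe_smul, Pi.add_apply, Pi.smul_apply, h1, h2,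
      Function.iterate_succ_apply', smul_eq_mul, mul_add d n 1, pow_add, mul_inv, mul_one]
    ring

lemma DyadicGrid.volume_ancestor (Q : CubeIndex d) (n : ℕ) :
    volume (G.cube (parent^[n] Q)) = 2 ^ (d * n) * volume (G.cube Q) := by
  have h : G.side (parent^[n] Q) = 2 ^ n * G.side Q := by
    induction n with
    | zero => simp
    | succ n ih =>
      rw [Function.iterate_succ_apply', pow_succ, mul_assoc, mul_left_comm, ← ih]
      simp only [DyadicGrid.side, parent, zpow_add_one₀ (two_ne_zero' ℝ)]
      ring
  rw [G.volume_cube, G.volume_cube, h, mul_pow, ENNReal.ofReal_mul (by positivity), ← pow_mul,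
    mul_comm n d, ENNReal.ofReal_pow zero_le_two]
  simp

lemma lintegral_cubeFun_rpow (Q : CubeIndex d) {p : ℝ} (hp : 0 < p) :
    ∫⁻ x, ‖cubeFun G 𝕜 Q x‖ₑ ^ p = volume (G.cube Q) := by
  rw [← lintegral_indicator_one (G.measurableSet_cube Q)]
  refine lintegral_congr fun x => ?_
  by_cases h : x ∈ G.cube Q
  · simp [cubeFun, h]
  · simp [cubeFun, h, hp]

lemma cubeFun_isBddFun (Q : CubeIndex d) : IsBddFun (cubeFun G 𝕜 Q) := by
  refine ⟨measurable_one.indicator (G.measurableSet_cube Q), ⟨1, fun x => ?_⟩,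
    (G.cube_isBounded Q).subset Set.support_indicator_subset⟩
  by_cases h : x ∈ G.cube Q <;> simp [cubeFun, h]

/-- The height contributes 2^(-dnp) and the volume 2^(dn). For p > 1 the factor decays geometrically
in n; for p = 1 it would not. -/
lemma lintegral_ancestor_rpow (Q : CubeIndex d) (n : ℕ) {p : ℝ} (hp : 0 < p) :
    ∫⁻ x, ‖((2 : 𝕜) ^ (d * n))⁻¹ * cubeFun G 𝕜 (parent^[n] Q) x‖ₑ ^ p =
      (2 ^ (1 - p)) ^ (d * n) * ∫⁻ x, ‖cubeFun G 𝕜 Q x‖ₑ ^ p := by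
  have h2 : ‖((2 : 𝕜) ^ (d * n))⁻¹‖ₑ = ((2 : ℝ≥0∞) ^ (d * n))⁻¹ := by
    rw [enorm_inv (by simp), enorm_pow, ← ofReal_norm, RCLike.norm_ofNat]
    simp
  simp only [enorm_mul, ENNReal.mul_rpow_of_nonneg _ _ hp.le]
  rw [lintegral_const_mul _ ((cubeFun_isBddFun G 𝕜 _).1.enorm.pow_const p),
    lintegral_cubeFun_rpow G 𝕜 _ hp, lintegral_cubeFun_rpow G 𝕜 _ hp, G.volume_ancestor, h2,
    ← mul_assoc]
  congr 1
  rw [ENNReal.inv_rpow, ← ENNReal.rpow_natCast, ← ENNReal.rpow_mul, ← ENNReal.rpow_neg,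
    ← ENNReal.rpow_add _ _ two_ne_zero ENNReal.ofNat_ne_top, ← ENNReal.rpow_natCast,
    ← ENNReal.rpow_mul]
  congr 1
  ring

end Telescoping

/-! ### Density of the tensor products of Haar sums, simultaneously in two Lebesgue spaces -/

section Density

open Filter Topology

variable {t : ℕ} {d : Fin t → ℕ} {𝕜 : Type*} [RCLike 𝕜] (G : ∀ s, DyadicGrid (d s))

variable (𝕜) in
/-- The tensor products of Haar sums inside `L^p × L^r`. -/
def haarPairs (p r : ℝ≥0∞) [Fact (1 ≤ p)] [Fact (1 ≤ r)] :
    Submodule 𝕜 (Lp 𝕜 p (volume : Measure (ProdSpace d)) ×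
      Lp 𝕜 r (volume : Measure (ProdSpace d))) :=
  (LinearMap.range ((tensorToLp 𝕜 G p).prod (tensorToLp 𝕜 G r))).topologicalClosure

/-- The function `f` can be approximated by tensor products of Haar sums in `L^p` and `L^r`
simultaneously. -/
def IsHaarApprox (p r : ℝ≥0∞) [Fact (1 ≤ p)] [Fact (1 ≤ r)] (f : ProdSpace d → 𝕜) : Prop :=
  ∃ (hp : MemLp f p volume) (hr : MemLp f r volume), (hp.toLp f, hr.toLp f) ∈ haarPairs 𝕜 G p r

variable {G} {p r : ℝ≥0∞} [Fact (1 ≤ p)] [Fact (1 ≤ r)] {f g : ProdSpace d → 𝕜}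

lemma isHaarApprox_tensorFun (u : HaarTensor 𝕜 G) : IsHaarApprox G p r (tensorFun 𝕜 G u) :=
  ⟨(tensorFun_isBddFun u).memLp p, (tensorFun_isBddFun u).memLp r,
    Submodule.le_topologicalClosure _ (LinearMap.mem_range.2 ⟨u, rfl⟩)⟩

lemma IsHaarApprox.add (hf : IsHaarApprox G p r f) (hg : IsHaarApprox G p r g) :
    IsHaarApprox G p r (f + g) := by
  obtain ⟨fp, fr, hf⟩ := hf
  obtain ⟨gp, gr, hg⟩ := hg
  exact ⟨fp.add gp, fr.add gr, (haarPairs 𝕜 G p r).add_mem hf hg⟩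

lemma IsHaarApprox.const_smul (hf : IsHaarApprox G p r f) (c : 𝕜) :
    IsHaarApprox G p r (c • f) := by
  obtain ⟨fp, fr, hf⟩ := hf
  exact ⟨fp.const_smul c, fr.const_smul c, (haarPairs 𝕜 G p r).smul_mem c hf⟩

lemma IsHaarApprox.zero : IsHaarApprox G p r (0 : ProdSpace d → 𝕜) := by
  have := isHaarApprox_tensorFun (p := p) (r := r) (0 : HaarTensor 𝕜 G)
  rwa [map_zero] at this

lemma IsHaarApprox.sum {ι : Type*} (S : Finset ι) {F : ι → ProdSpace d → 𝕜}
    (h : ∀ i ∈ S, IsHaarApprox G p r (F i)) : IsHaarApprox G p r (∑ i ∈ S, F i) :=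
  Finset.sum_induction _ _ (fun _ _ => IsHaarApprox.add) IsHaarApprox.zero h

lemma IsHaarApprox.congr_ae (hf : IsHaarApprox G p r f) (h : f =ᵐ[volume] g) :
    IsHaarApprox G p r g := by
  obtain ⟨fp, fr, hf⟩ := hf
  refine ⟨fp.ae_eq h, fr.ae_eq h, ?_⟩
  rwa [← MemLp.toLp_congr fp _ h, ← MemLp.toLp_congr fr _ h]

lemma IsHaarApprox.of_tendsto {F : ℕ → ProdSpace d → 𝕜} (hF : ∀ n, IsHaarApprox G p r (F n))
    (fp : MemLp f p volume) (fr : MemLp f r volume)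
    (hp : Tendsto (fun n => eLpNorm (F n - f) p volume) atTop (𝓝 0))
    (hr : Tendsto (fun n => eLpNorm (F n - f) r volume) atTop (𝓝 0)) :
    IsHaarApprox G p r f := by
  choose Fp Fr hF using hF
  refine ⟨fp, fr, (Submodule.isClosed_topologicalClosure _).mem_of_tendsto
    (Filter.Tendsto.prodMk_nhds ((Lp.tendsto_Lp_iff_tendsto_eLpNorm'' F Fp f fp).2 hp)
      ((Lp.tendsto_Lp_iff_tendsto_eLpNorm'' F Fr f fr).2 hr)) (.of_forall hF)⟩

/-! #### Indicators of boxes -/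

/-- The function `f_1(x_1) ⋯ f_t(x_t)`. -/
def prodFun (φ : ∀ s, (Fin (d s) → ℝ) → 𝕜) (x : ProdSpace d) : 𝕜 := ∏ s, φ s (x s)

lemma prodFun_isBddFun {φ : ∀ s, (Fin (d s) → ℝ) → 𝕜} (h : ∀ s, IsBddFun (φ s)) :
    IsBddFun (prodFun φ) := by
  choose C hC using fun s => (h s).2.1
  refine ⟨Finset.measurable_prod _ fun s _ => (h s).1.comp (measurable_pi_apply s),
    ⟨∏ s, C s, fun x => ?_⟩, (Bornology.IsBounded.pi fun s => (h s).2.2).subset ?_⟩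
  · rw [prodFun, norm_prod]
    exact Finset.prod_le_prod (fun _ _ => norm_nonneg _) fun s _ => hC s _
  · intro x hx s _
    exact Finset.prod_ne_zero_iff.1 hx s (Finset.mem_univ s)

lemma prodFun_update_apply_update (φ : ∀ s, (Fin (d s) → ℝ) → 𝕜) (s : Fin t)
    (w : (Fin (d s) → ℝ) → 𝕜) (x : ProdSpace d) (y : Fin (d s) → ℝ) :
    prodFun (Function.update φ s w) (Function.update x s y) =
      w y * ∏ i ∈ Finset.univ.erase s, φ i (x i) := by
  rw [prodFun, ← Finset.mul_prod_erase _ _ (Finset.mem_univ s), Function.update_self,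
    Function.update_self]
  congr 1
  refine Finset.prod_congr rfl fun i hi => ?_
  rw [Function.update_of_ne (Finset.ne_of_mem_erase hi),
    Function.update_of_ne (Finset.ne_of_mem_erase hi)]

lemma lintegral_prodFun_update_le {φ : ∀ s, (Fin (d s) → ℝ) → 𝕜} (hφ : ∀ s, IsBddFun (φ s))
    (s : Fin t) {w : (Fin (d s) → ℝ) → 𝕜} (hw : IsBddFun w) {q : ℝ} (hq : 0 < q) {D : ℝ≥0∞}
    (h : ∫⁻ y, ‖w y‖ₑ ^ q ≤ D * ∫⁻ y, ‖φ s y‖ₑ ^ q) :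
    ∫⁻ x, ‖prodFun (Function.update φ s w) x‖ₑ ^ q ≤ D * ∫⁻ x, ‖prodFun φ x‖ₑ ^ q := by
  have hb : ∀ i, IsBddFun (Function.update φ s w i) := fun i => by
    rcases eq_or_ne i s with rfl | hi
    · rwa [Function.update_self]
    · rw [Function.update_of_ne hi]; exact hφ i
  have hm := (prodFun_isBddFun hφ).1.enorm.pow_const q
  rw [← lintegral_const_mul _ hm]
  refine lintegral_le_of_update_le s ((prodFun_isBddFun hb).1.enorm.pow_const q)
    (hm.const_mul D) fun x => ?_
  have e : ∀ y, prodFun φ (Function.update x s y) =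
      φ s y * ∏ i ∈ Finset.univ.erase s, φ i (x i) := fun y => by
    conv_lhs => rw [← Function.update_eq_self s φ]
    exact prodFun_update_apply_update φ s (φ s) x y
  simp only [prodFun_update_apply_update, e, enorm_mul, ENNReal.mul_rpow_of_nonneg _ _ hq.le]
  simp only [← mul_assoc]
  rw [lintegral_mul_const _ (hw.1.enorm.pow_const q), lintegral_mul_const _
    (((hφ s).1.enorm.pow_const q).const_mul D), lintegral_const_mul _ ((hφ s).1.enorm.pow_const q)]
  gcongr

lemma tendsto_eLpNorm_of_lintegral_le {X : Type*} [MeasurableSpace X] {μ : Measure X}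
    {F : ℕ → X → 𝕜} {q : ℝ≥0∞} (hq : 1 < q) (hq' : q < ∞) {I : ℝ≥0∞} (hI : I ≠ ∞) {m : ℕ}
    (hm : 1 ≤ m)
    (h : ∀ n, ∫⁻ x, ‖F n x‖ₑ ^ q.toReal ∂μ ≤ (2 ^ (1 - q.toReal)) ^ (m * n) * I) :
    Tendsto (fun n => eLpNorm (F n) q μ) atTop (𝓝 0) := by
  have hq0 : q ≠ 0 := (zero_lt_one.trans hq).ne'
  have hqr : 1 < q.toReal := by
    rw [← ENNReal.toReal_one]
    exact (ENNReal.toReal_lt_toReal ENNReal.one_ne_top hq'.ne).2 hq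
  have h1 : ((2 : ℝ≥0∞) ^ (1 - q.toReal)) ^ m < 1 :=
    pow_lt_one' (ENNReal.rpow_lt_one_of_one_lt_of_neg (by norm_num) (by linarith)) (by omega)
  have h2 : Tendsto (fun n => ((2 : ℝ≥0∞) ^ (1 - q.toReal)) ^ (m * n) * I) atTop (𝓝 0) := by
    have := ENNReal.Tendsto.mul_const (b := I)
      (ENNReal.tendsto_pow_atTop_nhds_zero_of_lt_one h1) (Or.inr hI)
    simpa only [← pow_mul, zero_mul] using this
  have h3 : Tendsto (fun n => ∫⁻ x, ‖F n x‖ₑ ^ q.toReal ∂μ) atTop (𝓝 0) :=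
    tendsto_of_tendsto_of_tendsto_of_le_of_le tendsto_const_nhds h2 (fun _ => zero_le) h
  have h4 := h3.ennrpow_const (1 / q.toReal)
  rw [ENNReal.zero_rpow_of_pos (by positivity)] at h4
  simpa only [eLpNorm_eq_lintegral_rpow_enorm_toReal hq0 hq'.ne] using h4

lemma prodFun_update_sub (φ : ∀ s, (Fin (d s) → ℝ) → 𝕜) (s : Fin t)
    (v w : (Fin (d s) → ℝ) → 𝕜) :
    prodFun (Function.update φ s (fun y => v y - w y)) =
      prodFun (Function.update φ s v) - prodFun (Function.update φ s w) := by
  funext x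
  have h := fun w => prodFun_update_apply_update φ s w x (x s)
  simp only [Function.update_eq_self] at h
  rw [Pi.sub_apply, h, h, h, sub_mul]

lemma prodFun_ae_eq {φ ψ : ∀ s, (Fin (d s) → ℝ) → 𝕜} (h : ∀ s, φ s =ᵐ[volume] ψ s) :
    prodFun φ =ᵐ[volume] prodFun ψ := by
  have h1 : ∀ s, ∀ᵐ x : ProdSpace d, φ s (x s) = ψ s (x s) := fun s =>
    (Measure.quasiMeasurePreserving_eval (fun s => (volume : Measure (Fin (d s) → ℝ))) s).ae (h s)
  filter_upwards [ae_all_iff.2 h1] with x hx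
  exact Finset.prod_congr rfl fun s _ => hx s

/-- Products of indicators of cubes in some variables and Haar sums in the other variables. -/
lemma isHaarApprox_prodFun (hd : ∀ s, 1 ≤ d s) (hp : 1 < p) (hp' : p < ∞) (hr : 1 < r)
    (hr' : r < ∞) (Q : ∀ s, CubeIndex (d s)) (S : Finset (Fin t)) :
    ∀ φ : ∀ s, (Fin (d s) → ℝ) → 𝕜, (∀ s ∈ S, φ s = cubeFun (G s) 𝕜 (Q s)) →
      (∀ s ∉ S, φ s ∈ haarSpan 𝕜 (G s)) → IsHaarApprox G p r (prodFun φ) := by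
  induction S using Finset.induction_on with
  | empty =>
    intro φ _ h
    have := isHaarApprox_tensorFun (p := p) (r := r) (PiTensorProduct.tprod 𝕜 fun s =>
      (⟨φ s, h s (Finset.notMem_empty s)⟩ : haarSpan 𝕜 (G s)))
    exact this.congr_ae (.of_forall fun x => tensorFun_tprod _ x)
  | insert s S hs ih =>
    intro φ h1 h2
    have hb : ∀ i, IsBddFun (φ i) := fun i => by
      by_cases hi : i ∈ insert s S
      · rw [h1 i hi]; exact cubeFun_isBddFun _ _ _
      · exact haarSpan_isBddFun ⟨φ i, h2 i hi⟩
    have hφs := h1 s (Finset.mem_insert_self s S)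
    choose v hv using fun n => exists_haarSpan_ancestor_sub (G s) 𝕜 (Q s) n
    set w : ℕ → (Fin (d s) → ℝ) → 𝕜 := fun n y =>
      ((2 : 𝕜) ^ (d s * n))⁻¹ * cubeFun (G s) 𝕜 (parent^[n] (Q s)) y with hw
    have hwb : ∀ n, IsBddFun (w n) := fun n => (cubeFun_isBddFun (G s) 𝕜 _).smul _
    -- Exchanging the cube indicator in the variable s for a Haar sum leaves one indicator fewer, so
    -- the induction hypothesis applies. The error is again a product, with the spread-out ancestor
    -- as its factor in s.
    have hF : ∀ n, IsHaarApprox G p r (prodFun (Function.update φ s (v n))) := fun n => by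
      refine ih _ (fun i hi => ?_) fun i hi => ?_
      · rw [Function.update_of_ne (by rintro rfl; exact hs hi)]
        exact h1 i (Finset.mem_insert_of_mem hi)
      · rcases eq_or_ne i s with rfl | his
        · rw [Function.update_self]; exact (v n).2
        · rw [Function.update_of_ne his]
          exact h2 i fun hc => hi (Finset.mem_of_mem_insert_of_ne hc his)
    have hae : ∀ n, prodFun (Function.update φ s (v n)) - prodFun φ =ᵐ[volume]
        -prodFun (Function.update φ s (w n)) := fun n => by
      have e : prodFun (Function.update φ s (v n : (Fin (d s) → ℝ) → 𝕜)) =ᵐ[volume]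
          prodFun (Function.update φ s fun y => φ s y - w n y) := prodFun_ae_eq fun i => by
        rcases eq_or_ne i s with rfl | his
        · rw [Function.update_self, Function.update_self, hφs]; exact hv n
        · rw [Function.update_of_ne his, Function.update_of_ne his]
      filter_upwards [e] with x hx
      rw [Pi.sub_apply, hx, prodFun_update_sub, Function.update_eq_self, Pi.sub_apply,
        Pi.neg_apply]
      ring
    have hlim : ∀ q : ℝ≥0∞, 1 < q → q < ∞ → Tendsto (fun n =>
        eLpNorm (prodFun (Function.update φ s (v n)) - prodFun φ) q volume) atTop (𝓝 0) := by
      intro q hq hq'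
      have hq0 : 0 < q.toReal := ENNReal.toReal_pos (zero_lt_one.trans hq).ne' hq'.ne
      simp only [fun n => eLpNorm_congr_ae (p := q) (hae n), eLpNorm_neg]
      refine tendsto_eLpNorm_of_lintegral_le hq hq' (m := d s)
        (I := ∫⁻ x, ‖prodFun φ x‖ₑ ^ q.toReal) ?_ (hd s) fun n => ?_
      · exact (lintegral_rpow_enorm_lt_top_of_eLpNorm_lt_top (zero_lt_one.trans hq).ne' hq'.ne
          ((prodFun_isBddFun hb).memLp q).eLpNorm_lt_top).ne
      · refine lintegral_prodFun_update_le hb s (hwb n) hq0 ?_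
        rw [hφs]
        exact (lintegral_ancestor_rpow (G s) 𝕜 (Q s) n hq0).le
    exact IsHaarApprox.of_tendsto hF ((prodFun_isBddFun hb).memLp p)
      ((prodFun_isBddFun hb).memLp r) (hlim p hp hp') (hlim r hr hr')

variable (G) in
/-- The box of generation `k` with label `j`. -/
def box (k : ℤ) (j : ∀ s, Fin (d s) → ℤ) : Set (ProdSpace d) :=
  Set.univ.pi fun s => (G s).cube (k, j s)

variable (G) in
/-- The label of the box of generation `k` that contains a given point. -/
def boxLabel (k : ℤ) (x : ProdSpace d) : ∀ s, Fin (d s) → ℤ :=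
  fun s i => ⌊(x s i / (G s).scale - (G s).shift i) / (2 : ℝ) ^ k⌋

lemma mem_box {k : ℤ} {j : ∀ s, Fin (d s) → ℤ} {x : ProdSpace d} :
    x ∈ box G k j ↔ j = boxLabel G k x := by
  simp only [box, Set.mem_univ_pi, DyadicGrid.mem_cube_iff_floor, funext_iff, boxLabel]

lemma isHaarApprox_box (hd : ∀ s, 1 ≤ d s) (hp : 1 < p) (hp' : p < ∞) (hr : 1 < r)
    (hr' : r < ∞) (k : ℤ) (j : ∀ s, Fin (d s) → ℤ) :
    IsHaarApprox G p r ((box G k j).indicator (1 : ProdSpace d → 𝕜)) := by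
  refine (isHaarApprox_prodFun hd hp hp' hr hr' (fun s => (k, j s)) Finset.univ
    (fun s => cubeFun (G s) 𝕜 (k, j s)) (fun _ _ => rfl)
    fun s hs => absurd (Finset.mem_univ s) hs).congr_ae (.of_forall fun x => ?_)
  by_cases h : x ∈ box G k j
  · rw [Set.indicator_of_mem h, prodFun, Finset.prod_eq_one, Pi.one_apply]
    intro s _
    rw [cubeFun, Set.indicator_of_mem (h s trivial), Pi.one_apply]
  · rw [Set.indicator_of_notMem h]
    simp only [box, Set.mem_univ_pi, not_forall] at h
    obtain ⟨s, hs⟩ := h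
    exact Finset.prod_eq_zero (Finset.mem_univ s) (Set.indicator_of_notMem hs _)

lemma isHaarApprox_biUnion_box (hd : ∀ s, 1 ≤ d s) (hp : 1 < p) (hp' : p < ∞) (hr : 1 < r)
    (hr' : r < ∞) (k : ℤ) (J : Finset (∀ s, Fin (d s) → ℤ)) :
    IsHaarApprox G p r ((⋃ j ∈ J, box G k j).indicator (1 : ProdSpace d → 𝕜)) := by
  have h : (⋃ j ∈ J, box G k j).indicator (1 : ProdSpace d → 𝕜) =
      ∑ j ∈ J, (box G k j).indicator (1 : ProdSpace d → 𝕜) := by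
    classical
    funext x
    simp only [Finset.sum_apply, Set.indicator_apply, Set.mem_iUnion, mem_box, Pi.one_apply,
      exists_prop, exists_eq_right, Finset.sum_ite_eq']
  rw [h]
  exact IsHaarApprox.sum J fun j _ => isHaarApprox_box hd hp hp' hr hr' k j

end Density

/-! ### From boxes to measurable sets, simple functions and all of L^p ∩ L^r. -/

section Density

open Filter Topology

variable {t : ℕ} {d : Fin t → ℕ} {𝕜 : Type*} [RCLike 𝕜] {G : ∀ s, DyadicGrid (d s)}
  {p r : ℝ≥0∞} [Fact (1 ≤ p)] [Fact (1 ≤ r)]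

variable (G) in
lemma finite_image_boxLabel (k : ℤ) {K : Set (ProdSpace d)} (hK : Bornology.IsBounded K) :
    (boxLabel G k '' K).Finite := by
  obtain ⟨R, hR⟩ := hK.exists_norm_le
  refine (Set.finite_Icc (boxLabel G k fun _ _ => -R) (boxLabel G k fun _ _ => R)).subset ?_
  rintro _ ⟨x, hx, rfl⟩
  have hK : (0 : ℝ) < 2 ^ k := zpow_pos two_pos _
  have h : ∀ s i, |x s i| ≤ R := fun s i =>
    (norm_le_pi_norm (x s) i).trans ((norm_le_pi_norm x s).trans (hR x hx))
  have ha : ∀ s, 0 < (G s).scale := fun s => by linarith [(G s).one_le_scale]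
  constructor <;> intro s i <;> refine Int.floor_le_floor ?_ <;> have := ha s <;>
    have := abs_le.1 (h s i) <;> gcongr <;> linarith

lemma dist_lt_of_mem_box {k : ℤ} {x y : ProdSpace d} {j : ∀ s, Fin (d s) → ℤ}
    (hx : x ∈ box G k j) (hy : y ∈ box G k j) {δ : ℝ} (hδ0 : 0 < δ) (hδ : 2 * (2 : ℝ) ^ k ≤ δ) :
    dist x y < δ := by
  refine (dist_pi_lt_iff hδ0).2 fun s => (dist_pi_lt_iff hδ0).2 fun i => ?_
  have h1 := (G s).mem_cube.1 (hx s trivial) i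
  have h2 := (G s).mem_cube.1 (hy s trivial) i
  have h3 : (G s).side (k, j s) ≤ δ := by
    refine le_trans ?_ hδ
    exact mul_le_mul_of_nonneg_right (G s).scale_le_two (zpow_pos two_pos _).le
  rw [Real.dist_eq, abs_lt]
  constructor <;> linarith

variable (G) in
-- By regularity A lies between a compact K and an open U with U \ K small. The boxes of a fine
-- generation that meet K cover K and stay inside U.
lemma exists_biUnion_box_measure_symmDiff_le {A : Set (ProdSpace d)} (hA : MeasurableSet A)
    (hA' : volume A ≠ ∞) {ε : ℝ≥0∞} (hε : ε ≠ 0) :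
    ∃ (k : ℤ) (J : Finset (∀ s, Fin (d s) → ℤ)),
      volume (symmDiff (⋃ j ∈ J, box G k j) A) ≤ ε := by
  have hε2 : ε / 2 ≠ 0 := (ENNReal.half_pos hε).ne'
  obtain ⟨K, hKA, hK, hμK⟩ := hA.exists_isCompact_lt_add hA' hε2
  obtain ⟨U, hAU, hU, hμU⟩ := A.exists_isOpen_lt_add hA' hε2
  obtain ⟨δ, hδ, hKU⟩ := hK.exists_thickening_subset_open hU (hKA.trans hAU)
  obtain ⟨n, hn⟩ := exists_pow_lt_of_lt_one (half_pos hδ) (by norm_num : (1 / 2 : ℝ) < 1)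
  -- The factor 2 bounds the scale of every grid, so one generation is fine enough in all variables
  -- at once.
  have hk : 2 * (2 : ℝ) ^ (-(n : ℤ)) ≤ δ := by
    rw [zpow_neg, zpow_natCast, ← inv_pow]
    rw [one_div] at hn
    linarith
  refine ⟨-n, (finite_image_boxLabel G (-n) hK.isBounded).toFinset, ?_⟩
  set B := ⋃ j ∈ (finite_image_boxLabel G (-n) hK.isBounded).toFinset, box G (-n) j with hB
  have hKB : K ⊆ B := fun x hx => Set.mem_biUnion
    (by simpa using ⟨x, hx, rfl⟩ : boxLabel G (-n) x ∈
      ((finite_image_boxLabel G (-n) hK.isBounded).toFinset : Set (∀ s, Fin (d s) → ℤ)))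
    (mem_box.2 rfl)
  have hBU : B ⊆ U := by
    refine Set.iUnion₂_subset fun j hj y hy => hKU ?_
    obtain ⟨x, hx, rfl⟩ := (Set.Finite.mem_toFinset _).1 hj
    exact Metric.mem_thickening_iff.2 ⟨x, hx, dist_lt_of_mem_box hy (mem_box.2 rfl) hδ hk⟩
  have hsub : symmDiff B A ⊆ U \ K := by
    rintro x (⟨h1, h2⟩ | ⟨h1, h2⟩)
    · exact ⟨hBU h1, fun h => h2 (hKA h)⟩
    · exact ⟨hAU h1, fun h => h2 (hKB h)⟩
  have hKf : volume K ≠ ∞ := hK.measure_lt_top.ne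
  refine (measure_mono hsub).trans ?_
  rw [measure_sdiff (hKA.trans hAU) hK.measurableSet.nullMeasurableSet hKf, tsub_le_iff_right]
  calc volume U ≤ volume A + ε / 2 := hμU.le
    _ ≤ volume K + ε / 2 + ε / 2 := by gcongr
    _ = ε + volume K := by rw [add_assoc, ENNReal.add_halves, add_comm]

lemma memLp_indicator_one {A : Set (ProdSpace d)} (hA : MeasurableSet A) (hA' : volume A ≠ ∞)
    (q : ℝ≥0∞) : MemLp (A.indicator (1 : ProdSpace d → 𝕜)) q volume :=
  memLp_indicator_const q hA (1 : 𝕜) (Or.inr hA')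

lemma isHaarApprox_indicator (hd : ∀ s, 1 ≤ d s) (hp : 1 < p) (hp' : p < ∞) (hr : 1 < r)
    (hr' : r < ∞) {A : Set (ProdSpace d)} (hA : MeasurableSet A) (hA' : volume A ≠ ∞) :
    IsHaarApprox G p r (A.indicator (1 : ProdSpace d → 𝕜)) := by
  have h : ∀ n : ℕ, ∃ (k : ℤ) (J : Finset (∀ s, Fin (d s) → ℤ)),
      volume (symmDiff (⋃ j ∈ J, box G k j) A) ≤ ((n : ℝ≥0∞) + 1)⁻¹ := fun n =>
    exists_biUnion_box_measure_symmDiff_le G hA hA' (by simp)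
  choose k J h using h
  have hlim : ∀ q : ℝ≥0∞, 1 < q → q < ∞ → Tendsto (fun n =>
      eLpNorm ((⋃ j ∈ J n, box G (k n) j).indicator (1 : ProdSpace d → 𝕜) -
        A.indicator (1 : ProdSpace d → 𝕜)) q volume) atTop (𝓝 0) := by
    intro q hq hq'
    have hq0 : 0 < q.toReal := ENNReal.toReal_pos (zero_lt_one.trans hq).ne' hq'.ne
    have h1 : Tendsto (fun n : ℕ => ((n : ℝ≥0∞) + 1)⁻¹) atTop (𝓝 0) := by
      have := (tendsto_add_atTop_iff_nat 1).2 ENNReal.tendsto_inv_nat_nhds_zero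
      simpa using this
    have h2 := h1.ennrpow_const (1 / q.toReal)
    rw [ENNReal.zero_rpow_of_pos (by positivity)] at h2
    refine tendsto_of_tendsto_of_tendsto_of_le_of_le tendsto_const_nhds h2
      (fun _ => zero_le) fun n => ?_
    have h3 := eLpNorm_indicator_const_le (μ := (volume : Measure (ProdSpace d)))
      (s := symmDiff (⋃ j ∈ J n, box G (k n) j) A) (1 : 𝕜) q
    dsimp only
    rw [eLpNorm_indicator_sub_indicator]
    refine h3.trans ?_
    rw [enorm_one, one_mul]
    exact ENNReal.rpow_le_rpow (h n) (by positivity)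
  exact IsHaarApprox.of_tendsto (fun n => isHaarApprox_biUnion_box hd hp hp' hr hr' (k n) (J n))
    (memLp_indicator_one hA hA' p) (memLp_indicator_one hA hA' r) (hlim p hp hp') (hlim r hr hr')

lemma isHaarApprox_simpleFunc (hd : ∀ s, 1 ≤ d s) (hp : 1 < p) (hp' : p < ∞) (hr : 1 < r)
    (hr' : r < ∞) (f : SimpleFunc (ProdSpace d) 𝕜) (hf : MemLp f p volume) :
    IsHaarApprox G p r f := by
  induction f using SimpleFunc.induction with
  | @const c A hA =>
    have e : ⇑(SimpleFunc.piecewise A hA (SimpleFunc.const _ c) (SimpleFunc.const _ 0)) =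
        c • A.indicator (1 : ProdSpace d → 𝕜) := by
      funext x
      by_cases h : x ∈ A <;> simp [h]
    rcases eq_or_ne c 0 with rfl | hc
    · rw [e, zero_smul]; exact IsHaarApprox.zero
    · have hA' := SimpleFunc.measure_preimage_lt_top_of_memLp (zero_lt_one.trans hp).ne' hp'.ne _
        hf c hc
      rw [e]
      refine (isHaarApprox_indicator hd hp hp' hr hr' hA (ne_top_of_le_ne_top hA'.ne
        (measure_mono fun x hx => ?_))).const_smul c
      simp [hx]
  | @add f g hfg hf' hg' =>
    rw [SimpleFunc.coe_add, memLp_add_of_disjoint hfg f.stronglyMeasurable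
      g.stronglyMeasurable] at hf
    rw [SimpleFunc.coe_add]
    exact (hf' hf.1).add (hg' hf.2)

/-- Tensor products of Haar sums are dense in `L^p ∩ L^r`. -/
theorem isHaarApprox_of_memLp (hd : ∀ s, 1 ≤ d s) (hp : 1 < p) (hp' : p < ∞) (hr : 1 < r)
    (hr' : r < ∞) {f : ProdSpace d → 𝕜} (fp : MemLp f p volume) (fr : MemLp f r volume) :
    IsHaarApprox G p r f := by
  have hm := fp.1.stronglyMeasurable_mk
  have hae := fp.1.ae_eq_mk
  set g := fp.1.mk f
  have gp : MemLp g p volume := fp.ae_eq hae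
  have gr : MemLp g r volume := fr.ae_eq hae
  refine IsHaarApprox.congr_ae ?_ hae.symm
  -- The approximating simple functions depend only on g and not on the exponent, so a single
  -- sequence converges in both spaces.
  exact IsHaarApprox.of_tendsto (fun n => isHaarApprox_simpleFunc hd hp hp' hr hr' _
      (SimpleFunc.memLp_approxOn_range hm.measurable gp n)) gp gr
    (SimpleFunc.tendsto_approxOn_range_Lp_eLpNorm hp'.ne hm.measurable gp.2)
    (SimpleFunc.tendsto_approxOn_range_Lp_eLpNorm hr'.ne hm.measurable gr.2)

/-- Simultaneous approximation in two Lebesgue spaces by tensor products of Haar sums. -/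
theorem exists_seq_tensorToLp_tendsto (hd : ∀ s, 1 ≤ d s) (hp : 1 < p) (hp' : p < ∞) (hr : 1 < r)
    (hr' : r < ∞) {f : ProdSpace d → 𝕜} (fp : MemLp f p volume) (fr : MemLp f r volume) :
    ∃ u : ℕ → HaarTensor 𝕜 G,
      Tendsto (fun n => tensorToLp 𝕜 G p (u n)) atTop (𝓝 (fp.toLp f)) ∧
      Tendsto (fun n => tensorToLp 𝕜 G r (u n)) atTop (𝓝 (fr.toLp f)) := by
  obtain ⟨_, _, h⟩ := isHaarApprox_of_memLp (G := G) hd hp hp' hr hr' fp fr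
  rw [haarPairs, ← SetLike.mem_coe, Submodule.topologicalClosure_coe,
    mem_closure_iff_seq_limit] at h
  obtain ⟨v, hv, hlim⟩ := h
  choose u hu using fun n => LinearMap.mem_range.1 (hv n)
  refine ⟨u, ?_, ?_⟩
  · have := (continuous_fst.tendsto _).comp hlim
    refine this.congr fun n => ?_
    rw [Function.comp_apply, ← hu n]; rfl
  · have := (continuous_snd.tendsto _).comp hlim
    refine this.congr fun n => ?_
    rw [Function.comp_apply, ← hu n]; rfl

lemma denseRange_tensorToLp (hd : ∀ s, 1 ≤ d s) (hp : 1 < p) (hp' : p < ∞) :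
    DenseRange (tensorToLp 𝕜 G p) := fun f => by
  have hf := Lp.memLp f
  obtain ⟨u, hu, -⟩ := exists_seq_tensorToLp_tendsto (G := G) hd hp hp' hp hp' hf hf
  rw [Lp.toLp_coeFn] at hu
  exact mem_closure_of_tendsto hu (.of_forall fun n => Set.mem_range_self _)

end Density

/-! ### The tensor product of Haar shifts as a bounded operator -/

section Extension

open Filter Topology

lemma exists_extension_of_norm_le {𝕜 E F₁ F₂ : Type*} [RCLike 𝕜] [AddCommMonoid E] [Module 𝕜 E]
    [NormedAddCommGroup F₁] [NormedSpace 𝕜 F₁] [NormedAddCommGroup F₂] [NormedSpace 𝕜 F₂]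
    [CompleteSpace F₂] (f : E →ₗ[𝕜] F₂) (e : E →ₗ[𝕜] F₁) (he : DenseRange e)
    (h : ∃ C : ℝ, ∀ x, ‖f x‖ ≤ C * ‖e x‖) : ∃ T : F₁ →L[𝕜] F₂, ∀ x, T (e x) = f x := by
  -- Multiplication by the scalar -1 supplies negatives, which turns the additive monoid E into a
  -- group.
  let _ : AddCommGroup E := Module.addCommMonoidToAddCommGroup 𝕜
  exact ⟨f.extendOfNorm e, LinearMap.extendOfNorm_eq he h⟩

variable {t : ℕ} {d : Fin t → ℕ} {𝕜 : Type*} [RCLike 𝕜] {G : ∀ s, DyadicGrid (d s)}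

lemma coeFn_tensorToLp (p : ℝ≥0∞) (u : HaarTensor 𝕜 G) :
    tensorToLp 𝕜 G p u =ᵐ[volume] tensorFun 𝕜 G u :=
  MemLp.coeFn_toLp ((tensorFun_isBddFun u).memLp p)

variable {p r : ℝ≥0∞} [Fact (1 ≤ p)] [Fact (1 ≤ r)]

theorem exists_extendsTensorShift (hd : ∀ s, 1 ≤ d s) (hp : 1 < p) (hp' : p < ∞)
    (σ : ∀ s, ShiftData (G s)) :
    ∃ T : Lp 𝕜 p (volume : Measure (ProdSpace d)) →L[𝕜] Lp 𝕜 p (volume : Measure (ProdSpace d)),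
      ExtendsTensorShift σ p T :=
  exists_extension_of_norm_le (tensorToLp 𝕜 G p ∘ₗ tensorShift 𝕜 σ) (tensorToLp 𝕜 G p)
    (denseRange_tensorToLp hd hp hp') (exists_norm_tensorShift_le 𝕜 hd hp hp' σ)

theorem ExtendsTensorShift.unique (hd : ∀ s, 1 ≤ d s) (hp : 1 < p) (hp' : p < ∞)
    {σ : ∀ s, ShiftData (G s)}
    {T₁ T₂ : Lp 𝕜 p (volume : Measure (ProdSpace d)) →L[𝕜]
      Lp 𝕜 p (volume : Measure (ProdSpace d))}
    (h₁ : ExtendsTensorShift σ p T₁) (h₂ : ExtendsTensorShift σ p T₂) : T₁ = T₂ :=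
  DFunLike.coe_injective ((denseRange_tensorToLp (G := G) hd hp hp').equalizer T₁.continuous
    T₂.continuous (funext fun u => (h₁ u).trans (h₂ u).symm))

/-- One sequence of tensors approximates f in both norms. On it both operators produce the same
functions, whose limits in L^p and L^r are also limits in measure and hence coincide almost
everywhere. -/
theorem ExtendsTensorShift.ae_eq (hd : ∀ s, 1 ≤ d s) (hp : 1 < p) (hp' : p < ∞) (hr : 1 < r)
    (hr' : r < ∞) {σ : ∀ s, ShiftData (G s)}
    {T : Lp 𝕜 p (volume : Measure (ProdSpace d)) →L[𝕜] Lp 𝕜 p (volume : Measure (ProdSpace d))}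
    {S : Lp 𝕜 r (volume : Measure (ProdSpace d)) →L[𝕜] Lp 𝕜 r (volume : Measure (ProdSpace d))}
    (hT : ExtendsTensorShift σ p T) (hS : ExtendsTensorShift σ r S) {f : ProdSpace d → 𝕜}
    (fp : MemLp f p volume) (fr : MemLp f r volume) : T (fp.toLp f) =ᵐ[volume] S (fr.toLp f) := by
  obtain ⟨u, hu, hu'⟩ := exists_seq_tensorToLp_tendsto (G := G) hd hp hp' hr hr' fp fr
  have h1 := tendstoInMeasure_of_tendsto_Lp ((T.continuous.tendsto _).comp hu)
  have h2 := tendstoInMeasure_of_tendsto_Lp ((S.continuous.tendsto _).comp hu')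
  simp only [Function.comp_apply, hT _, hS _] at h1 h2
  refine tendstoInMeasure_ae_unique h1 (h2.congr_left fun n => ?_)
  exact (coeFn_tensorToLp r _).trans (coeFn_tensorToLp p _).symm

end Extension

end DyadicHaar

end

theorem mainTheorem3 {𝕜 : Type*} [RCLike 𝕜] {t : ℕ} (d : Fin t → ℕ) (hd : ∀ s, 1 ≤ d s)
    (G : ∀ s, DyadicHaar.DyadicGrid (d s)) (σ : ∀ s, DyadicHaar.ShiftData (G s)) :
    ∃ Q₂ : Lp 𝕜 2 (volume : Measure (DyadicHaar.ProdSpace d)) →L[𝕜]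
        Lp 𝕜 2 (volume : Measure (DyadicHaar.ProdSpace d)),
      DyadicHaar.ExtendsTensorShift σ 2 Q₂ ∧
      ∀ (p : ℝ≥0∞) [Fact (1 ≤ p)], 1 < p → p < ∞ →
        ∃ T : Lp 𝕜 p (volume : Measure (DyadicHaar.ProdSpace d)) →L[𝕜]
            Lp 𝕜 p (volume : Measure (DyadicHaar.ProdSpace d)),
          DyadicHaar.ExtendsTensorShift σ p T ∧
          (∀ T₁, DyadicHaar.ExtendsTensorShift σ p T₁ → T₁ = T) ∧
          ∀ (f : DyadicHaar.ProdSpace d → 𝕜) (hf₂ : MemLp f 2 volume) (hf : MemLp f p volume),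
            T (hf.toLp f) =ᵐ[volume] Q₂ (hf₂.toLp f) := by
  have h2 : (1 : ℝ≥0∞) < 2 := by norm_num
  have h2' : (2 : ℝ≥0∞) < ∞ := by simp
  obtain ⟨Q₂, hQ₂⟩ := DyadicHaar.exists_extendsTensorShift (𝕜 := 𝕜) hd h2 h2' σ
  refine ⟨Q₂, hQ₂, fun p _ hp hp' => ?_⟩
  obtain ⟨T, hT⟩ := DyadicHaar.exists_extendsTensorShift (𝕜 := 𝕜) hd hp hp' σ
  exact ⟨T, hT, fun T₁ hT₁ => hT₁.unique hd hp hp' hT,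
    fun f hf₂ hf => hT.ae_eq hd hp hp' h2 h2' hQ₂ hf hf₂⟩
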